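/- Let $n\ge 0$ be an integer, $x_1,x_2,x_3\in\mathbb R$, $\alpha_1,\alpha_2,\alpha_3\in\mathbb C$ and $\tau>0$. For $z=(z_1,\dots,z_n)\in\mathbb R^n$ put $$\Phi(z)=\prod_{i=1}^n |x_1-z_i|^{\alpha_1-1}|x_2-z_i|^{\alpha_2-1}|x_3-z_i|^{\alpha_3-1}\prod_{1\le j<k\le n}|z_j-z_k|^{2\tau}.$$ Let $\Delta\subset\mathbb R^n$ be a bounded region whose boundary is contained in the union of the hyperplanes $z_i=x_a$ ($1\le i\le n$, $a=1,2,3$) and $z_j=z_k$ ($j\ne k$), and over which $\Phi$ is absolutely integrable. (For example, if $x_1,x_2,x_3$ are the numbers $0,x,1$ in some order, $0<x<1$, and $\mathrm{Re}\,\alpha_a>0$ for $a=1,2,3$, one may take $\Delta=[0,x]^p\times[0,1]^{n-p}$, $0\le p\le n$.) For polynomials $\phi$ in $z$ put $$\langle\phi\rangle=\int_\Delta\phi(z)\Phi(z)\,dz_1\cdots dz_n,\qquad T_{\alpha_1}\langle\phi\rangle=\Big\langle\prod_{i=1}^n(z_i-x_1)\,\phi\Big\rangle .$$ For $i=0,1,\dots,n$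 let $$\varphi_i(z)=\prod_{k=1}^{n-i}(x_2-z_k)\prod_{k=n-i+1}^{n}(x_3-z_k),$$ and write $(x;\tau)_0=1$, $(x;\tau)_m=x(x+\tau)\cdots(x+(m-1)\tau)$ for $m\ge1$. Let $\tilde U=(\tilde u_{ij})_{0\le i,j\le n}$ be the upper triangular matrix with $\tilde u_{ij}=0$ for $i>j$ and, for $i\le j$, $$\tilde u_{ij}=\binom ji\big(\alpha_1+\alpha_2+\alpha_3+(n+j-1)\tau;\tau\big)_{n-j}\big(\alpha_3+(n-j)\tau;\tau\big)_{j-i}\big(\alpha_1+\alpha_2+(j-1)\tau;\tau\big)_i ,$$ and let $\tilde L=(\tilde l_{ij})_{0\le i,j\le n}$ be the lower triangular matrix with $\tilde l_{ij}=0$ for $i<j$ and, for $i\ge j$, $$\tilde l_{ij}=(-1)^{i-j}\binom{n-j}{n-i}(\alpha_1;\tau)_j(\alpha_2+j\tau;\tau)_{i-j}\big(\alpha_1+\alpha_2+(i+j)\tau;\tau\big)_{n-i}(x_3-x_1)^{n-i}(x_2-x_1)^i .$$ (a) If $\Delta$ is invariant under all permutations of the coordinates, then $$T_{\alpha_1}\big(\langle\varphi_0\rangle,\langle\varphi_1\rangle,\dots,\langle\varphi_n\rangle\big)\,\tilde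 U=\big(\langle\varphi_0\rangle,\langle\varphi_1\rangle,\dots,\langle\varphi_n\rangle\big)\,\tilde L .$$ (b) Whether or not $\Delta$ is invariant under permutations, the same identity holds with every $\varphi_i$ replaced by its symmetrization $\frac1{n!}\sum_{\sigma\in\mathfrak S_n}\varphi_i(z_{\sigma(1)},\dots,z_{\sigma(n)})$. -/

import Mathlib

open scoped Matrix

noncomputable section

/-- The Pochhammer-type product `(x; τ)_m = x (x + τ) ⋯ (x + (m - 1) τ)`, with `(x; τ)_0 = 1`. -/
def stepPoch (x τ : ℂ) (m : ℕ) : ℂ :=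
  ∏ k ∈ Finset.range m, (x + (k : ℂ) * τ)

/-- The integrand `Φ(z) = ∏ᵢ |x₁ - zᵢ|^(α₁-1) |x₂ - zᵢ|^(α₂-1) |x₃ - zᵢ|^(α₃-1) ∏_{j<k} |zⱼ - zₖ|^(2τ)`
on `ℝⁿ`, with real `x₁ x₂ x₃`, complex `α₁ α₂ α₃` and real `τ`. -/
def selbergPhi {n : ℕ} (x₁ x₂ x₃ : ℝ) (α₁ α₂ α₃ : ℂ) (τ : ℝ) (z : Fin n → ℝ) : ℂ :=
  (∏ i, (((|x₁ - z i| : ℝ) : ℂ) ^ (α₁ - 1) * ((|x₂ - z i| : ℝ) : ℂ) ^ (α₂ - 1) *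
      ((|x₃ - z i| : ℝ) : ℂ) ^ (α₃ - 1))) *
    ((∏ j, ∏ k ∈ Finset.Ioi j, |z j - z k| ^ (2 * τ) : ℝ) : ℂ)

/-- The (unnormalised) average `⟨φ⟩ = ∫_Δ φ(z) Φ(z) dz₁ ⋯ dzₙ`. -/
def selbergAvg {n : ℕ} (Δ : Set (Fin n → ℝ)) (x₁ x₂ x₃ : ℝ) (α₁ α₂ α₃ : ℂ) (τ : ℝ)
    (φ : (Fin n → ℝ) → ℂ) : ℂ :=
  ∫ z in Δ, φ z * selbergPhi x₁ x₂ x₃ α₁ α₂ α₃ τ z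

/-- The shift operator `T`, sending a functional `φ ↦ ⟨φ⟩` to the functional
`φ ↦ ⟨∏ᵢ (zᵢ - y) φ⟩`.  The operator `T_{α₁}` is the case `y = x₁`. -/
def shiftOp {n : ℕ} (y : ℝ) (F : ((Fin n → ℝ) → ℂ) → ℂ) (φ : (Fin n → ℝ) → ℂ) : ℂ :=
  F (fun z => (∏ i, ((z i - y : ℝ) : ℂ)) * φ z)

/-- `φᵢ(z) = (x₂ - z₁) ⋯ (x₂ - z_{n-i}) (x₃ - z_{n-i+1}) ⋯ (x₃ - zₙ)` for `i = 0, …, n`.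
The coordinates of `z` are numbered from `0` here. -/
def basisPoly {n : ℕ} (x₂ x₃ : ℝ) (i : Fin (n + 1)) (z : Fin n → ℝ) : ℂ :=
  ∏ k : Fin n, if (k : ℕ) < n - (i : ℕ) then ((x₂ - z k : ℝ) : ℂ) else ((x₃ - z k : ℝ) : ℂ)

/-- The symmetrisation `(1 / n!) ∑_σ φ(z_{σ(1)}, …, z_{σ(n)})` of a function of `n` variables. -/
def symmetrize {n : ℕ} (φ : (Fin n → ℝ) → ℂ) (z : Fin n → ℝ) : ℂ :=
  ((Nat.factorial n : ℕ) : ℂ)⁻¹ * ∑ σ : Equiv.Perm (Fin n), φ (fun k => z (σ k))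

/-- The union of the hyperplanes `zᵢ = x₁`, `zᵢ = x₂`, `zᵢ = x₃` and `zⱼ = zₖ` (`j ≠ k`), that is,
the places where a factor of `Φ` has base zero. -/
def singularSet (n : ℕ) (x₁ x₂ x₃ : ℝ) : Set (Fin n → ℝ) :=
  {z | (∃ i, z i = x₁ ∨ z i = x₂ ∨ z i = x₃) ∨ ∃ j k, j ≠ k ∧ z j = z k}

/-- Admissible regions of integration: `Δ` is bounded (so that polynomials are bounded on `Δ`),
its boundary lies in the zero hyperplanes of the factors of `Φ`, and the integral of `Φ` over `Δ`
converges absolutely.  If all the exponents have positive real part, the boundary condition says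
exactly that `Φ` vanishes on the boundary of `Δ`; it is imposed on the hyperplanes, and not on the
values of `Φ`, so that the usual range `Re αₐ > 0` is included. -/
structure IsSelbergRegion {n : ℕ} (Δ : Set (Fin n → ℝ)) (x₁ x₂ x₃ : ℝ) (α₁ α₂ α₃ : ℂ)
    (τ : ℝ) : Prop where
  bounded : Bornology.IsBounded Δ
  frontier_subset : frontier Δ ⊆ singularSet n x₁ x₂ x₃
  integrable : MeasureTheory.IntegrableOn (selbergPhi x₁ x₂ x₃ α₁ α₂ α₃ τ) Δ

/-- The upper triangular matrix `Ũ`. -/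
def uTilde (n : ℕ) (α₁ α₂ α₃ : ℂ) (τ : ℝ) : Matrix (Fin (n + 1)) (Fin (n + 1)) ℂ :=
  Matrix.of fun i j =>
    if i ≤ j then
      (((j : ℕ).choose (i : ℕ) : ℕ) : ℂ) *
        stepPoch (α₁ + α₂ + α₃ + ((n : ℂ) + ((j : ℕ) : ℂ) - 1) * τ) τ (n - (j : ℕ)) *
        stepPoch (α₃ + ((n : ℂ) - ((j : ℕ) : ℂ)) * τ) τ ((j : ℕ) - (i : ℕ)) *
        stepPoch (α₁ + α₂ + (((j : ℕ) : ℂ) - 1) * τ) τ (i : ℕ)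
    else 0

/-- The lower triangular matrix `L̃`. -/
def lTilde (n : ℕ) (x₁ x₂ x₃ : ℝ) (α₁ α₂ : ℂ) (τ : ℝ) :
    Matrix (Fin (n + 1)) (Fin (n + 1)) ℂ :=
  Matrix.of fun i j =>
    if j ≤ i then
      (-1 : ℂ) ^ ((i : ℕ) - (j : ℕ)) *
        (((n - (j : ℕ)).choose (n - (i : ℕ)) : ℕ) : ℂ) *
        stepPoch α₁ τ (j : ℕ) *
        stepPoch (α₂ + ((j : ℕ) : ℂ) * τ) τ ((i : ℕ) - (j : ℕ)) *
        stepPoch (α₁ + α₂ + (((i : ℕ) : ℂ) + ((j : ℕ) : ℂ)) * τ) τ (n - (i : ℕ)) *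
        ((x₃ - x₁ : ℝ) : ℂ) ^ (n - (i : ℕ)) * ((x₂ - x₁ : ℝ) : ℂ) ^ (i : ℕ)
    else 0

end

/-! The identity holds column by column: for each `j` the difference of the two integrands is the
divergence of a vector field times `Φ`, divided by `Φ`.

The symmetric polynomials involved are encoded in `ℂ[X 0, X 1, X 2]`, where the variable `X a`
belongs to the `a`-th of the points `x₁, x₂, x₃`. A polynomial `f` is sent to the function of `z`
obtained by pairing it, in the Fischer product, with `∏ₖ ∑ₐ qₐ(zₖ) Xₐ`, where `qₐ(y) = -∏_{b ≠ a} (y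
- x_b)`. Since the pairing of two products of linear forms is a permanent, `X₂^(n-i) X₁^i` gives `n!
∏ (zₖ - x₁)` times the symmetrized `φᵢ`. Since `q₂ - q₀` and `q₁ - q₀` are, up to constants, `x₂ -
y` and `x₃ - y`, `(X₂ - X₀)^(n-i) (X₁ - X₀)^i` gives the symmetrized `φᵢ` itself, up to a constant
(`fischer_X_pow_mul_X_pow`, `fischer_sub_pow_mul_sub_pow`).

Under this encoding the fields `Vᵢ = -∏_b (zᵢ - x_b) · ⟨f, ∏_{k ≠ i} …⟩` have as divergence of `V Φ`
the image of `selbergRel f`, times `Φ` (`integral_fischer_selbergRel`). They are tangent to every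
singular hyperplane, so a logarithmic cutoff justifies Stokes' formula under absolute integrability
alone (`integral_divergence_eq_zero`).

What remains is algebra modulo the range of `selbergRel` (`column_mem_range`): both sides of column
`j` are congruent to the same multiple of `X₂^(n-j) (X₁ - X₀)^j`. This proves (b); for symmetric `Δ`
symmetrization does not change averages, which gives (a). -/

theorem stepPoch_zero (x τ : ℂ) : stepPoch x τ 0 = 1 := by simp [stepPoch]

theorem stepPoch_succ (x τ : ℂ) (m : ℕ) :
    stepPoch x τ (m + 1) = stepPoch x τ m * (x + m * τ) := by
  simp [stepPoch, Finset.prod_range_succ]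

theorem stepPoch_succ' (x τ : ℂ) (m : ℕ) :
    stepPoch x τ (m + 1) = x * stepPoch (x + τ) τ m := by
  simp only [stepPoch, Finset.prod_range_succ']
  rw [mul_comm]
  congr 1
  · simp
  · refine Finset.prod_congr rfl fun k _ => ?_
    push_cast
    ring

/-! ### Congruences modulo the range of `selbergRel`. -/

section Algebra

open MvPolynomial

/-- The derivation `∑ Xᵢ² ∂ᵢ`. -/
noncomputable def sqDerivation : Derivation ℂ (MvPolynomial (Fin 3) ℂ) (MvPolynomial (Fin 3) ℂ) :=
  ∑ i : Fin 3, (X i ^ 2 : MvPolynomial (Fin 3) ℂ) • pderiv i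

theorem sqDerivation_apply (f : MvPolynomial (Fin 3) ℂ) :
    sqDerivation f = ∑ i : Fin 3, X i ^ 2 * pderiv i f := by
  have : sqDerivation f = ∑ i : Fin 3,
      ((X i ^ 2 : MvPolynomial (Fin 3) ℂ) • pderiv (R := ℂ) i) f := by
    rw [sqDerivation]
    simp only [Fin.sum_univ_three, Derivation.add_apply]
  rw [this]
  simp only [Derivation.smul_apply, smul_eq_mul]

theorem sqDerivation_X (i : Fin 3) : sqDerivation (X i) = X i ^ 2 := by
  rw [sqDerivation_apply]
  simp [pderiv_X, Pi.single_apply]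

/-- The operator `f ↦ (a X₀ + b X₁ + c X₂) f + t ∑ Xᵢ² ∂ᵢ f`, whose image consists of the
polynomials with vanishing Selberg average. -/
noncomputable def selbergRel (a b c t : ℂ) :
    MvPolynomial (Fin 3) ℂ →ₗ[ℂ] MvPolynomial (Fin 3) ℂ :=
  LinearMap.mulLeft ℂ (C a * X 0 + C b * X 1 + C c * X 2) + t • sqDerivation.toLinearMap

theorem selbergRel_apply (a b c t : ℂ) (f : MvPolynomial (Fin 3) ℂ) :
    selbergRel a b c t f =
      (C a * X 0 + C b * X 1 + C c * X 2) * f + C t * sqDerivation f := by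
  simp [selbergRel, C_mul']

/-- The derivation sends `X 1 - X 0` to `(X 1 - X 0) * (X 1 + X 0)`, and the cofactor is absorbed
into the linear term by shifting `a` and `b`. Thus congruences may be multiplied by `X 1 - X 0` at
the cost of a parameter shift; `X 2` likewise shifts `c`. -/
theorem selbergRel_sub_mul (a b c t : ℂ) (f : MvPolynomial (Fin 3) ℂ) :
    selbergRel a b c t ((X 1 - X 0) * f) = (X 1 - X 0) * selbergRel (a + t) (b + t) c t f := by
  simp only [selbergRel_apply, Derivation.leibniz, map_sub, sqDerivation_X, smul_eq_mul, C_add]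
  ring

theorem selbergRel_X_mul (a b c t : ℂ) (f : MvPolynomial (Fin 3) ℂ) :
    selbergRel a b c t (X 2 * f) = X 2 * selbergRel a b (c + t) t f := by
  simp only [selbergRel_apply, Derivation.leibniz, sqDerivation_X, smul_eq_mul, C_add]
  ring

theorem sub_mul_mem_range {a b c t : ℂ} {f : MvPolynomial (Fin 3) ℂ}
    (hf : f ∈ LinearMap.range (selbergRel (a + t) (b + t) c t)) :
    (X 1 - X 0) * f ∈ LinearMap.range (selbergRel a b c t) := by
  obtain ⟨w, rfl⟩ := hf
  exact ⟨_, selbergRel_sub_mul a b c t w⟩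

theorem X_mul_mem_range {a b c t : ℂ} {f : MvPolynomial (Fin 3) ℂ}
    (hf : f ∈ LinearMap.range (selbergRel a b (c + t) t)) :
    X 2 * f ∈ LinearMap.range (selbergRel a b c t) := by
  obtain ⟨w, rfl⟩ := hf
  exact ⟨_, selbergRel_X_mul a b c t w⟩

theorem sub_pow_mul_mem_range {a b c t : ℂ} {f : MvPolynomial (Fin 3) ℂ} (m : ℕ)
    (hf : f ∈ LinearMap.range (selbergRel (a + m * t) (b + m * t) c t)) :
    (X 1 - X 0) ^ m * f ∈ LinearMap.range (selbergRel a b c t) := by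
  induction m generalizing a b with
  | zero => simpa using hf
  | succ m ih =>
    rw [pow_succ', mul_assoc]
    refine sub_mul_mem_range (ih ?_)
    convert hf using 3 <;> push_cast <;> ring

theorem X_pow_mul_mem_range {a b c t : ℂ} {f : MvPolynomial (Fin 3) ℂ} (m : ℕ)
    (hf : f ∈ LinearMap.range (selbergRel a b (c + m * t) t)) :
    X 2 ^ m * f ∈ LinearMap.range (selbergRel a b c t) := by
  induction m generalizing c with
  | zero => simpa using hf
  | succ m ih =>
    rw [pow_succ', mul_assoc]
    refine X_mul_mem_range (ih ?_)
    convert hf using 3; push_cast; ring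

theorem sqDerivation_C_mul (c : ℂ) (f : MvPolynomial (Fin 3) ℂ) :
    sqDerivation (C c * f) = C c * sqDerivation f := by
  rw [C_mul', Derivation.map_smul, C_mul']

theorem sqDerivation_pow {u e : MvPolynomial (Fin 3) ℂ} (h : sqDerivation u = u * e) (m : ℕ) :
    sqDerivation (u ^ m) = u ^ m * (m * e) := by
  induction m with
  | zero => simp
  | succ m ih =>
    rw [pow_succ, Derivation.leibniz, ih, h, smul_eq_mul, smul_eq_mul]
    push_cast
    ring

/-- A two-term recursion for coefficients, summed. -/
theorem sum_range_succ_eq_of_recursion {A : Type*} [CommRing A] {n : ℕ} {p q r : ℕ → A}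
    (M : ℕ → A) (hp : p n = 0) (h0 : r 0 = p 0) (hr : ∀ i < n, r (i + 1) = p (i + 1) + q i) :
    ∑ i ∈ Finset.range (n + 1), r i * M i =
      ∑ i ∈ Finset.range n, (p i * M i + q i * M (i + 1)) := by
  have hS : ∑ i ∈ Finset.range n, p i * M i = ∑ i ∈ Finset.range (n + 1), p i * M i := by
    rw [Finset.sum_range_succ, hp, zero_mul, add_zero]
  rw [Finset.sum_add_distrib, hS, Finset.sum_range_succ', Finset.sum_range_succ', h0,
    add_right_comm, ← Finset.sum_add_distrib]
  congr 1
  refine Finset.sum_congr rfl fun i hi => ?_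
  rw [hr i (Finset.mem_range.1 hi)]
  ring

/-- A weighted Pascal rule: the coefficient recursions in both inductions below reduce to it. -/
theorem choose_weighted_recursion (c t : ℂ) (m i : ℕ) (hi : i ≤ m) :
    (m.choose (i + 1) : ℂ) * (c + (m + 1 + i) * t) + (m.choose i : ℂ) * (c + i * t) =
      ((m + 1).choose (i + 1) : ℂ) * (c + m * t) := by
  have h : (m.choose (i + 1) : ℂ) * (i + 1) = (m.choose i : ℂ) * (m - i) := by
    have := Nat.choose_succ_right_eq m i
    rw [← Nat.cast_sub hi]
    exact_mod_cast this
  rw [Nat.choose_succ_succ]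
  push_cast
  linear_combination t * h

/-- Induction by multiplying the case `(a + t, b + t)` by `a * (X 1 - X 0)`. The relations applied
to the monomials `X₂^(m-i) X₁^i` then trade `a * (X 1 - X 0)` for a combination of `X 2` and `X 1`.
-/
theorem sum_X_pow_sub_mem_range (n : ℕ) (a b c t : ℂ) :
    (∑ i ∈ Finset.range (n + 1), C ((n.choose i : ℂ) * stepPoch c t (n - i) *
        stepPoch (a + b + ((n : ℂ) - 1) * t) t i) * (X 2 ^ (n - i) * X 1 ^ i)) -
      C (stepPoch a t n) * (X 1 - X 0) ^ n ∈ LinearMap.range (selbergRel a b c t) := by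
  induction n generalizing a b with
  | zero => simp [stepPoch_zero]
  | succ m ih =>
    have h1 := sub_mul_mem_range (ih (a + t) (b + t))
    set p : ℕ → ℂ := fun i => (m.choose i : ℂ) * stepPoch c t (m - i) *
      stepPoch (a + b + ((m : ℂ) + 1) * t) t i with hp
    have h2 : ∀ i ∈ Finset.range (m + 1), C (p i) *
        ((C (c + (m - i : ℕ) * t) * (X 2 ^ (m + 1 - i) * X 1 ^ i) +
          C (a + b + i * t) * (X 2 ^ (m - i) * X 1 ^ (i + 1))) -
          C a * (X 1 - X 0) * (X 2 ^ (m - i) * X 1 ^ i)) ∈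
        LinearMap.range (selbergRel a b c t) := by
      intro i hi
      rw [Finset.mem_range] at hi
      refine ⟨C (p i) * (X 2 ^ (m - i) * X 1 ^ i), ?_⟩
      have hX : ∀ j : Fin 3, sqDerivation (X j) = X j * X j := fun j => by
        rw [sqDerivation_X, sq]
      rw [selbergRel_apply, sqDerivation_C_mul, Derivation.leibniz, sqDerivation_pow (hX 1),
        sqDerivation_pow (hX 2), smul_eq_mul, smul_eq_mul,
        show m + 1 - i = m - i + 1 by omega]
      simp only [C_add, C_mul, map_natCast]
      ring
    have h3 := Submodule.add_mem _ (Submodule.smul_mem _ a h1) (Submodule.sum_mem _ h2)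
    convert h3 using 1
    have hsum := sum_range_succ_eq_of_recursion (n := m + 1)
      (p := fun i => C (p i * (c + (m - i : ℕ) * t)))
      (q := fun i => C (p i * (a + b + i * t)))
      (r := fun i => C (((m + 1).choose i : ℂ) * stepPoch c t (m + 1 - i) *
        stepPoch (a + b + (((m + 1 : ℕ) : ℂ) - 1) * t) t i))
      (fun i => (X 2 ^ (m + 1 - i) * X 1 ^ i : MvPolynomial (Fin 3) ℂ))
      (by simp [hp]) (by simp [hp, stepPoch_succ, stepPoch_zero]) (by
        intro i hi
        rw [← C_add]
        congr 1
        have hc := choose_weighted_recursion (a + b) t m i (by omega)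
        rcases Nat.lt_or_ge i m with him | him
        · obtain ⟨k, rfl⟩ : ∃ k, m = i + 1 + k := ⟨m - (i + 1), by omega⟩
          simp only [hp]
          rw [show i + 1 + k + 1 - (i + 1) = k + 1 by omega, show i + 1 + k - (i + 1) = k by omega,
            show i + 1 + k - i = k + 1 by omega, stepPoch_succ c, stepPoch_succ' _ _ i,
            stepPoch_succ _ _ i]
          push_cast at hc ⊢
          rw [show a + b + ((i : ℂ) + 1 + k + 1 - 1) * t + t = a + b + (i + 1 + k + 1) * t by ring]
          linear_combination (-stepPoch c t k * (c + k * t) *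
            stepPoch (a + b + (i + 1 + k + 1) * t) t i) * hc
        · obtain rfl : i = m := by omega
          simp only [hp]
          simp only [Nat.choose_self, Nat.choose_succ_self, Nat.sub_self, stepPoch_zero,
            stepPoch_succ']
          push_cast
          rw [show a + b + ((i : ℂ) + 1 - 1) * t + t = a + b + (i + 1) * t by ring]
          ring)
    rw [hsum]
    have e1 : ∀ i ∈ Finset.range (m + 1),
        C (p i * (c + (m - i : ℕ) * t)) * (X 2 ^ (m + 1 - i) * X 1 ^ i) +
          C (p i * (a + b + i * t)) * (X 2 ^ (m + 1 - (i + 1)) * X 1 ^ (i + 1)) =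
        (C a * (X 1 - X 0)) * (C (p i) * (X 2 ^ (m - i) * X 1 ^ i)) + C (p i) *
        ((C (c + (m - i : ℕ) * t) * (X 2 ^ (m + 1 - i) * X 1 ^ i) +
          C (a + b + i * t) * (X 2 ^ (m - i) * X 1 ^ (i + 1))) -
          C a * (X 1 - X 0) * (X 2 ^ (m - i) * X 1 ^ i) : MvPolynomial (Fin 3) ℂ) := by
      intro i _
      generalize p i = r
      rw [Nat.add_sub_add_right]
      simp only [C_mul]
      ring
    rw [Finset.sum_congr rfl e1, Finset.sum_add_distrib, ← Finset.mul_sum, stepPoch_succ',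
      smul_eq_C_mul, C_mul]
    have e2 : a + t + (b + t) + ((m : ℂ) - 1) * t = a + b + (m + 1) * t := by ring
    simp only [hp, e2]
    ring

/-- The dual induction: the case `c + t` is multiplied by `(a + b + c + 2mt) * X 2`, and the
relations applied to `(X₂ - X₀)^(m-i) (X₁ - X₀)^i` re-express that factor through the two
differences. -/
theorem X_pow_sub_sum_mem_range (n : ℕ) (a b c t : ℂ) :
    C (stepPoch (a + b + c + ((n : ℂ) - 1) * t) t n) * X 2 ^ n -
      (∑ i ∈ Finset.range (n + 1), C ((-1) ^ i * (n.choose i : ℂ) * stepPoch b t i *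
        stepPoch (a + b + i * t) t (n - i)) * ((X 2 - X 0) ^ (n - i) * (X 1 - X 0) ^ i)) ∈
      LinearMap.range (selbergRel a b c t) := by
  induction n generalizing c with
  | zero => simp [stepPoch_zero]
  | succ m ih =>
    have h1 := X_mul_mem_range (ih (c + t))
    set p : ℕ → ℂ := fun i => (-1) ^ i * (m.choose i : ℂ) * stepPoch b t i *
        stepPoch (a + b + i * t) t (m - i) with hp
    have h2 : ∀ i ∈ Finset.range (m + 1), C (p i) *
        (C (a + b + c + 2 * m * t) * X 2 * ((X 2 - X 0) ^ (m - i) * (X 1 - X 0) ^ i) -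
          (C (a + b + (m + i) * t) * ((X 2 - X 0) ^ (m + 1 - i) * (X 1 - X 0) ^ i) +
          C (-(b + i * t)) * ((X 2 - X 0) ^ (m - i) * (X 1 - X 0) ^ (i + 1)))) ∈
        LinearMap.range (selbergRel a b c t) := by
      intro i hi
      rw [Finset.mem_range] at hi
      refine ⟨C (p i) * ((X 2 - X 0) ^ (m - i) * (X 1 - X 0) ^ i), ?_⟩
      -- At `j = 0` both sides vanish, so no case distinction is needed.
      have hX : ∀ j : Fin 3, sqDerivation (X j - X 0) = (X j - X 0) * (X j + X 0) := fun j => by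
        rw [map_sub, sqDerivation_X, sqDerivation_X]
        ring
      rw [selbergRel_apply, sqDerivation_C_mul, Derivation.leibniz, sqDerivation_pow (hX 1),
        sqDerivation_pow (hX 2), smul_eq_mul, smul_eq_mul]
      obtain ⟨k, rfl⟩ : ∃ k, m = i + k := ⟨m - i, by omega⟩
      rw [show i + k + 1 - i = k + 1 by omega, show i + k - i = k by omega]
      simp only [C_add, C_mul, map_natCast, C_neg, Nat.cast_add, map_ofNat]
      ring
    have h3 := Submodule.add_mem _ (Submodule.smul_mem _ (a + b + c + 2 * m * t) h1)
      (Submodule.sum_mem _ h2)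
    convert h3 using 1
    have hsum := sum_range_succ_eq_of_recursion (n := m + 1)
      (p := fun i => C (p i * (a + b + (m + i) * t)))
      (q := fun i => C (p i * (-(b + i * t))))
      (r := fun i => C ((-1) ^ i * ((m + 1).choose i : ℂ) * stepPoch b t i *
        stepPoch (a + b + i * t) t (m + 1 - i)))
      (fun i => ((X 2 - X 0) ^ (m + 1 - i) * (X 1 - X 0) ^ i : MvPolynomial (Fin 3) ℂ))
      (by simp [hp]) (by simp [hp, stepPoch_succ, stepPoch_zero]) (by
        intro i hi
        rw [← C_add]
        congr 1
        have hc := choose_weighted_recursion (a + b) t m i (by omega)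
        rcases Nat.lt_or_ge i m with him | him
        · obtain ⟨k, rfl⟩ : ∃ k, m = i + 1 + k := ⟨m - (i + 1), by omega⟩
          simp only [hp]
          rw [show i + 1 + k + 1 - (i + 1) = k + 1 by omega, show i + 1 + k - (i + 1) = k by omega,
            show i + 1 + k - i = k + 1 by omega, stepPoch_succ b, stepPoch_succ _ _ k,
            stepPoch_succ' _ _ k]
          push_cast at hc ⊢
          rw [show a + b + (i : ℂ) * t + t = a + b + (i + 1) * t by ring]
          linear_combination ((-1) ^ i * stepPoch b t i * (b + i * t) *
            stepPoch (a + b + (i + 1) * t) t k) * hc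
        · obtain rfl : i = m := by omega
          simp only [hp]
          simp only [Nat.choose_self, Nat.choose_succ_self, Nat.sub_self, stepPoch_zero,
            stepPoch_succ]
          push_cast
          ring)
    rw [hsum]
    have e1 : ∀ i ∈ Finset.range (m + 1),
        C (p i * (a + b + (m + i) * t)) * ((X 2 - X 0) ^ (m + 1 - i) * (X 1 - X 0) ^ i) +
          C (p i * (-(b + i * t))) *
            ((X 2 - X 0) ^ (m + 1 - (i + 1)) * (X 1 - X 0) ^ (i + 1)) =
        (C (a + b + c + 2 * m * t) * X 2) *
            (C (p i) * ((X 2 - X 0) ^ (m - i) * (X 1 - X 0) ^ i)) - C (p i) *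
        (C (a + b + c + 2 * m * t) * X 2 * ((X 2 - X 0) ^ (m - i) * (X 1 - X 0) ^ i) -
          (C (a + b + (m + i) * t) * ((X 2 - X 0) ^ (m + 1 - i) * (X 1 - X 0) ^ i) +
          C (-(b + i * t)) * ((X 2 - X 0) ^ (m - i) * (X 1 - X 0) ^ (i + 1))) :
            MvPolynomial (Fin 3) ℂ) := by
      intro i _
      generalize p i = r
      rw [Nat.add_sub_add_right]
      simp only [C_mul]
      ring
    rw [Finset.sum_congr rfl e1, Finset.sum_sub_distrib, ← Finset.mul_sum, stepPoch_succ,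
      smul_eq_C_mul, C_mul]
    push_cast
    rw [show a + b + (c + t) + ((m : ℂ) - 1) * t = a + b + c + (m + 1 - 1) * t by ring,
      show a + b + c + ((m : ℂ) + 1 - 1) * t + m * t = a + b + c + 2 * m * t by ring]
    ring

/-- With `k = n - j`, the first expansion multiplied by `X₂^k` and the second multiplied by `(X₁ -
X₀)^j` meet in a common multiple of `X₂^k (X₁ - X₀)^j`, which cancels. -/
theorem column_mem_range (n j : ℕ) (hj : j ≤ n) (a b c t : ℂ) :
    (∑ i ∈ Finset.range (j + 1), C ((j.choose i : ℂ) *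
        stepPoch (a + b + c + ((n : ℂ) + j - 1) * t) t (n - j) *
        stepPoch (c + ((n : ℂ) - j) * t) t (j - i) *
        stepPoch (a + b + ((j : ℂ) - 1) * t) t i) * (X 2 ^ (n - i) * X 1 ^ i)) -
      (∑ i ∈ Finset.range (n - j + 1), C ((-1) ^ i * ((n - j).choose i : ℂ) *
        stepPoch a t j * stepPoch (b + j * t) t i *
        stepPoch (a + b + (i + 2 * j) * t) t (n - j - i)) *
          ((X 2 - X 0) ^ (n - j - i) * (X 1 - X 0) ^ (i + j))) ∈
      LinearMap.range (selbergRel a b c t) := by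
  obtain ⟨k, rfl⟩ : ∃ k, n = j + k := ⟨n - j, by omega⟩
  rw [Nat.add_sub_cancel_left]
  have h1 := Submodule.smul_mem _ (stepPoch (a + b + c + ((j + k : ℕ) + (j : ℂ) - 1) * t) t k)
    (X_pow_mul_mem_range k (sum_X_pow_sub_mem_range j a b (c + k * t) t))
  have h2 := Submodule.smul_mem _ (stepPoch a t j)
    (sub_pow_mul_mem_range j (X_pow_sub_sum_mem_range k (a + j * t) (b + j * t) c t))
  convert Submodule.add_mem _ h1 h2 using 1
  rw [smul_eq_C_mul, smul_eq_C_mul, mul_sub, mul_sub, mul_sub, mul_sub, Finset.mul_sum,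
    Finset.mul_sum, Finset.mul_sum, Finset.mul_sum]
  have e1 : a + j * t + (b + j * t) + c + ((k : ℂ) - 1) * t =
      a + b + c + ((j + k : ℕ) + (j : ℂ) - 1) * t := by push_cast; ring
  rw [e1]
  have s1 : ∀ i ∈ Finset.range (j + 1), C ((j.choose i : ℂ) *
        stepPoch (a + b + c + (((j + k : ℕ) : ℂ) + j - 1) * t) t k *
        stepPoch (c + (((j + k : ℕ) : ℂ) - j) * t) t (j - i) *
        stepPoch (a + b + ((j : ℂ) - 1) * t) t i) * (X 2 ^ (j + k - i) * X 1 ^ i) =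
      C (stepPoch (a + b + c + ((j + k : ℕ) + (j : ℂ) - 1) * t) t k) * (X 2 ^ k *
        (C ((j.choose i : ℂ) * stepPoch (c + k * t) t (j - i) *
        stepPoch (a + b + ((j : ℂ) - 1) * t) t i) *
          (X 2 ^ (j - i) * X 1 ^ i) : MvPolynomial (Fin 3) ℂ)) := by
    intro i hi
    rw [Finset.mem_range] at hi
    rw [show j + k - i = k + (j - i) by omega, pow_add,
      show ((j + k : ℕ) : ℂ) - j = k by push_cast; ring]
    simp only [C_mul]
    ring
  have s2 : ∀ i ∈ Finset.range (k + 1), C ((-1) ^ i * (k.choose i : ℂ) *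
        stepPoch a t j * stepPoch (b + j * t) t i *
        stepPoch (a + b + (i + 2 * j) * t) t (k - i)) *
          ((X 2 - X 0) ^ (k - i) * (X 1 - X 0) ^ (i + j)) =
      C (stepPoch a t j) * ((X 1 - X 0) ^ j * (C ((-1) ^ i * (k.choose i : ℂ) *
        stepPoch (b + j * t) t i *
        stepPoch (a + j * t + (b + j * t) + i * t) t (k - i)) *
          ((X 2 - X 0) ^ (k - i) * (X 1 - X 0) ^ i) : MvPolynomial (Fin 3) ℂ)) := by
    intro i _
    rw [show a + j * t + (b + j * t) + (i : ℂ) * t = a + b + (i + 2 * j) * t by ring, pow_add]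
    simp only [C_mul]
    ring
  rw [Finset.sum_congr rfl s1, Finset.sum_congr rfl s2]
  ring

end Algebra

/-! ### The Fischer pairing and the adjoint of `selbergRel`. -/

section Fischer

open MvPolynomial

/-- The Fischer (apolar) pairing: `⟨Xᵐ, Xᵐ⟩ = m!`, distinct monomials being orthogonal. -/
noncomputable def fischer :
    MvPolynomial (Fin 3) ℂ →ₗ[ℂ] MvPolynomial (Fin 3) ℂ →ₗ[ℂ] ℂ :=
  (basisMonomials (Fin 3) ℂ).constr ℂ fun m =>
    ((∏ a, (m a).factorial : ℕ) : ℂ) • lcoeff ℂ m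

theorem fischer_monomial (m : Fin 3 →₀ ℕ) (c : ℂ) (P : MvPolynomial (Fin 3) ℂ) :
    fischer (monomial m c) P = c * ((∏ a, (m a).factorial : ℕ) : ℂ) * coeff m P := by
  have h : monomial m c = c • basisMonomials (Fin 3) ℂ m := by
    simp [coe_basisMonomials, smul_monomial]
  rw [h, map_smul, fischer, Module.Basis.constr_basis]
  simp [mul_assoc]

theorem fischer_comm (f P : MvPolynomial (Fin 3) ℂ) : fischer f P = fischer P f := by
  induction f using MvPolynomial.induction_on' with
  | monomial m c =>
    induction P using MvPolynomial.induction_on' with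
    | monomial m' c' =>
      rw [fischer_monomial, fischer_monomial, coeff_monomial, coeff_monomial]
      by_cases h : m = m'
      · subst h
        simp
        ring
      · simp [h, Ne.symm h]
    | add p q hp hq => simp only [map_add, LinearMap.add_apply, hp, hq]
  | add p q hp hq => simp only [map_add, LinearMap.add_apply, hp, hq]

theorem fischer_pderiv (a : Fin 3) (f P : MvPolynomial (Fin 3) ℂ) :
    fischer (pderiv a f) P = fischer f (X a * P) := by
  induction f using MvPolynomial.induction_on' with
  | monomial m c =>
    rw [pderiv_monomial, fischer_monomial, fischer_monomial, coeff_X_mul']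
    by_cases h : m a = 0
    · simp [h]
    · have hm : a ∈ m.support := by simpa using h
      rw [if_pos hm]
      have hfac : (∏ b, (m b).factorial) =
          m a * ∏ b, ((m - Finsupp.single a 1 : Fin 3 →₀ ℕ) b).factorial := by
        rw [← Finset.mul_prod_erase _ _ (Finset.mem_univ a),
          ← Finset.mul_prod_erase Finset.univ
            (fun b => ((m - Finsupp.single a 1 : Fin 3 →₀ ℕ) b).factorial) (Finset.mem_univ a),
          ← mul_assoc]
        congr 1
        · simp [Nat.mul_factorial_pred h]
        · refine Finset.prod_congr rfl fun b hb => ?_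
          rw [Finset.mem_erase] at hb
          simp [hb.1.symm]
      rw [hfac]
      push_cast
      ring
  | add p q hp hq => simp only [map_add, LinearMap.add_apply, hp, hq]

theorem fischer_X_mul (a : Fin 3) (f P : MvPolynomial (Fin 3) ℂ) :
    fischer (X a * f) P = fischer f (pderiv a P) := by
  rw [fischer_comm, ← fischer_pderiv, fischer_comm]

/-- The linear form with coefficients `c`. -/
noncomputable def linForm (c : Fin 3 → ℂ) : MvPolynomial (Fin 3) ℂ := ∑ a, c a • X a

theorem pderiv_linForm (a : Fin 3) (c : Fin 3 → ℂ) : pderiv a (linForm c) = C (c a) := by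
  simp [linForm, map_sum, pderiv_X, Pi.single_apply, smul_eq_C_mul]

theorem pderiv_prod_linForm {ι : Type*} [DecidableEq ι] (a : Fin 3) (v : ι → Fin 3 → ℂ)
    (s : Finset ι) :
    pderiv a (∏ k ∈ s, linForm (v k)) = ∑ i ∈ s, v i a • ∏ k ∈ s.erase i, linForm (v k) := by
  induction s using Finset.induction_on with
  | empty => simp
  | insert i s hi ih =>
    rw [Finset.prod_insert hi, Derivation.leibniz, ih, pderiv_linForm, Finset.sum_insert hi,
      Finset.erase_insert hi, add_comm, smul_eq_mul, smul_eq_mul, mul_comm _ (C _), C_mul',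
      Finset.mul_sum]
    congr 1
    refine Finset.sum_congr rfl fun j hj => ?_
    have hij : i ≠ j := fun h => hi (h ▸ hj)
    rw [Finset.erase_insert_of_ne hij, Finset.prod_insert (by simp [hi]), mul_smul_comm]

/-- The enumeration by `swap 0 i` is chosen to match `Equiv.Perm.decomposeFin` in the permanent
expansion. -/
theorem prod_erase_eq_prod_swap_succ {M : Type*} [CommMonoid M] {n : ℕ} (i : Fin (n + 1))
    (f : Fin (n + 1) → M) :
    ∏ k ∈ Finset.univ.erase i, f k = ∏ k : Fin n, f (Equiv.swap 0 i k.succ) := by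
  symm
  refine Finset.prod_bij (fun k _ => Equiv.swap 0 i k.succ) ?_ ?_ ?_ fun _ _ => rfl
  · intro k _
    rw [Finset.mem_erase]
    refine ⟨fun h => ?_, Finset.mem_univ _⟩
    rw [Equiv.swap_apply_eq_iff, Equiv.swap_apply_right] at h
    exact Fin.succ_ne_zero k h
  · intro k _ l _ h
    exact Fin.succ_injective _ ((Equiv.swap 0 i).injective h)
  · intro b hb
    rw [Finset.mem_erase] at hb
    have : Equiv.swap 0 i b ≠ 0 := by
      rw [Ne, Equiv.swap_apply_eq_iff, Equiv.swap_apply_left]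
      exact hb.1
    obtain ⟨k, hk⟩ := Fin.exists_succ_eq.2 this
    exact ⟨k, Finset.mem_univ _, by rw [hk, Equiv.swap_apply_self]⟩

/-- The pairing is a permanent. Multiplication by a linear form is adjoint to a directional
derivative, so peeling off the first form expands the permanent along its first row. -/
theorem fischer_prod_linForm {n : ℕ} (c v : Fin n → Fin 3 → ℂ) :
    fischer (∏ k, linForm (c k)) (∏ k, linForm (v k)) =
      ∑ σ : Equiv.Perm (Fin n), ∏ k, c k ⬝ᵥ v (σ k) := by
  induction n with
  | zero =>
    simp only [Finset.univ_eq_empty, Finset.prod_empty, Finset.sum_const, Finset.card_univ]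
    rw [show (1 : MvPolynomial (Fin 3) ℂ) = monomial 0 1 from rfl, fischer_monomial]
    simp
  | succ n ih =>
    rw [Fin.prod_univ_succ]
    have h1 : ∀ f P : MvPolynomial (Fin 3) ℂ, fischer (linForm (c 0) * f) P =
        ∑ a, c 0 a * fischer f (pderiv a P) := by
      intro f P
      simp only [linForm, Finset.sum_mul, map_sum, LinearMap.sum_apply, smul_mul_assoc, map_smul,
        LinearMap.smul_apply, fischer_X_mul, smul_eq_mul]
    rw [h1]
    simp only [pderiv_prod_linForm, map_sum, map_smul, smul_eq_mul, prod_erase_eq_prod_swap_succ]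
    have h2 : ∀ i : Fin (n + 1), fischer (∏ k : Fin n, linForm (c k.succ))
        (∏ k : Fin n, linForm (v (Equiv.swap 0 i k.succ))) =
        ∑ σ : Equiv.Perm (Fin n), ∏ k, c (Fin.succ k) ⬝ᵥ v (Equiv.swap 0 i (σ k).succ) :=
      fun i => ih (fun k => c k.succ) fun k => v (Equiv.swap 0 i k.succ)
    simp only [h2]
    rw [← Equiv.sum_comp Equiv.Perm.decomposeFin.symm, Fintype.sum_prod_type]
    simp only [Finset.mul_sum]
    rw [Finset.sum_comm]
    refine Finset.sum_congr rfl fun i _ => ?_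
    rw [Finset.sum_comm]
    refine Finset.sum_congr rfl fun σ _ => ?_
    rw [Fin.prod_univ_succ]
    simp only [Equiv.Perm.decomposeFin_symm_apply_zero, Equiv.Perm.decomposeFin_symm_apply_succ]
    rw [dotProduct, Finset.sum_mul]
    exact Finset.sum_congr rfl fun a _ => by ring

/-- The adjoint is `∑ αₐ ∂ₐ + t ∑ Xₐ ∂ₐ²`. On a product of linear forms its second-order part yields
a sum over pairs of factors, which will match the terms coming from `|zⱼ - zₖ|^(2τ)`. -/
theorem fischer_selbergRel (α : Fin 3 → ℂ) (t : ℂ) (f P : MvPolynomial (Fin 3) ℂ) :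
    fischer (selbergRel (α 0) (α 1) (α 2) t f) P =
      ∑ a, (α a * fischer f (pderiv a P) + t * fischer f (X a * pderiv a (pderiv a P))) := by
  have h1 : selbergRel (α 0) (α 1) (α 2) t f =
      ∑ a, (α a • (X a * f) + t • (X a * (X a * pderiv a f))) := by
    rw [selbergRel_apply, sqDerivation_apply]
    simp only [smul_eq_C_mul, Fin.sum_univ_three]
    ring
  rw [h1]
  simp only [map_sum, LinearMap.sum_apply, map_add, LinearMap.add_apply, map_smul,
    LinearMap.smul_apply, fischer_X_mul, fischer_pderiv, smul_eq_mul]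

theorem fischer_selbergRel_prod_linForm {n : ℕ} (α : Fin 3 → ℂ) (t : ℂ)
    (f : MvPolynomial (Fin 3) ℂ) (v : Fin n → Fin 3 → ℂ) :
    fischer (selbergRel (α 0) (α 1) (α 2) t f) (∏ k, linForm (v k)) =
      (∑ i, (∑ a, α a * v i a) * fischer f (∏ k ∈ Finset.univ.erase i, linForm (v k))) +
      t * ∑ i, ∑ j ∈ Finset.univ.erase i, ∑ a, v i a * v j a *
        fischer f (X a * ∏ k ∈ (Finset.univ.erase i).erase j, linForm (v k)) := by
  rw [fischer_selbergRel, Finset.sum_add_distrib]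
  congr 1
  · simp only [pderiv_prod_linForm, map_sum, map_smul, smul_eq_mul, Finset.mul_sum,
      Finset.sum_mul]
    rw [Finset.sum_comm]
    exact Finset.sum_congr rfl fun i _ => Finset.sum_congr rfl fun a _ => by ring
  · rw [← Finset.mul_sum]
    congr 1
    simp only [pderiv_prod_linForm, map_sum, Derivation.map_smul, map_smul, smul_eq_mul,
      Finset.mul_sum, mul_smul_comm]
    rw [Finset.sum_comm]
    refine Finset.sum_congr rfl fun i _ => ?_
    rw [Finset.sum_comm]
    exact Finset.sum_congr rfl fun j _ => Finset.sum_congr rfl fun a _ => by ring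

end Fischer

/-! ### Stokes' formula for fields tangent to the singular hyperplanes. -/

section Stokes

open MeasureTheory Filter Topology

variable {n : ℕ}

/-- The product of the linear forms defining the singular hyperplanes. -/
noncomputable def hyperplaneProd (x : Fin 3 → ℝ) (z : Fin n → ℝ) : ℝ :=
  (∏ i, ∏ a, (z i - x a)) * ∏ j, ∏ k ∈ Finset.Ioi j, (z j - z k)

theorem hyperplaneProd_eq_zero_iff (x : Fin 3 → ℝ) (z : Fin n → ℝ) :
    hyperplaneProd x z = 0 ↔ z ∈ singularSet n (x 0) (x 1) (x 2) := by
  simp only [hyperplaneProd, mul_eq_zero, Finset.prod_eq_zero_iff, Finset.mem_univ, true_and,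
    sub_eq_zero, Finset.mem_Ioi, singularSet, Set.mem_ofPred_eq, Fin.exists_fin_succ]
  simp only [IsEmpty.exists_iff, or_false]
  refine or_congr Iff.rfl ⟨?_, ?_⟩
  · rintro ⟨j, k, hjk, h⟩
    exact ⟨j, k, hjk.ne, h⟩
  · rintro ⟨j, k, hjk, h⟩
    rcases hjk.lt_or_gt with h' | h'
    · exact ⟨j, k, h', h⟩
    · exact ⟨k, j, h', h.symm⟩

theorem continuous_hyperplaneProd (x : Fin 3 → ℝ) :
    Continuous (hyperplaneProd (n := n) x) := by
  unfold hyperplaneProd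
  fun_prop

theorem isOpen_compl_singularSet (x : Fin 3 → ℝ) :
    IsOpen (singularSet n (x 0) (x 1) (x 2))ᶜ := by
  have : (singularSet n (x 0) (x 1) (x 2))ᶜ = {z | hyperplaneProd x z ≠ 0} := by
    ext z
    simp [hyperplaneProd_eq_zero_iff]
  rw [this]
  exact isOpen_ne_fun (continuous_hyperplaneProd x) continuous_const

theorem volume_singularSet (x₁ x₂ x₃ : ℝ) : volume (singularSet n x₁ x₂ x₃) = 0 := by
  have h1 : ∀ (i : Fin n) (c : ℝ), volume {z : Fin n → ℝ | z i = c} = 0 := fun i c =>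
    Measure.pi_hyperplane (α := fun _ => ℝ) (fun _ => volume) i c
  have h2 : ∀ j k : Fin n, j ≠ k → volume {z : Fin n → ℝ | z j = z k} = 0 := by
    intro j k hjk
    have : {z : Fin n → ℝ | z j = z k} =
        (LinearMap.ker (LinearMap.proj (R := ℝ) (φ := fun _ : Fin n => ℝ) j -
          LinearMap.proj k) : Set (Fin n → ℝ)) := by
      ext z
      simp [sub_eq_zero]
    rw [this]
    refine Measure.addHaar_submodule _ _ fun h => ?_
    have h3 : (Pi.single j 1 : Fin n → ℝ) ∈ LinearMap.ker
        (LinearMap.proj (R := ℝ) (φ := fun _ : Fin n => ℝ) j - LinearMap.proj k) := by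
      rw [h]
      trivial
    simp [hjk.symm] at h3
  have h4 : singularSet n x₁ x₂ x₃ ⊆
      (⋃ i, ({z | z i = x₁} ∪ {z | z i = x₂} ∪ {z | z i = x₃})) ∪
        ⋃ p : {p : Fin n × Fin n // p.1 ≠ p.2}, {z | z p.1.1 = z p.1.2} := by
    rintro z (⟨i, h⟩ | ⟨j, k, hjk, h⟩)
    · refine Or.inl (Set.mem_iUnion.2 ⟨i, ?_⟩)
      simpa [or_assoc] using h
    · exact Or.inr (Set.mem_iUnion.2 ⟨⟨(j, k), hjk⟩, h⟩)
  refine measure_mono_null h4 (measure_union_null ?_ ?_)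
  · exact measure_iUnion_null fun i =>
      measure_union_null (measure_union_null (h1 i _) (h1 i _)) (h1 i _)
  · exact measure_iUnion_null fun p => h2 _ _ p.2

/-- A weighted sum of the logarithms of the linear forms defining the singular hyperplanes. -/
noncomputable def logSum (x : Fin 3 → ℝ) (β : Fin 3 → ℂ) (γ : ℂ) (z : Fin n → ℝ) : ℂ :=
  (∑ i, ∑ a, β a * (Real.log (z i - x a) : ℂ)) +
    γ * ∑ j, ∑ k ∈ Finset.Ioi j, (Real.log (z j - z k) : ℂ)

theorem sub_ne_zero_of_notMem_singularSet {x : Fin 3 → ℝ} {z : Fin n → ℝ}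
    (hz : z ∉ singularSet n (x 0) (x 1) (x 2)) :
    (∀ i a, z i - x a ≠ 0) ∧ ∀ j k, j ≠ k → z j - z k ≠ 0 := by
  refine ⟨fun i a h => hz (Or.inl ⟨i, ?_⟩), fun j k hjk h =>
    hz (Or.inr ⟨j, k, hjk, sub_eq_zero.1 h⟩)⟩
  rw [sub_eq_zero] at h
  fin_cases a
  · exact Or.inl h
  · exact Or.inr (Or.inl h)
  · exact Or.inr (Or.inr h)

/-- `Real.log` ignores signs, so `logSum` covers both the logarithm of `|hyperplaneProd|`, used for
the cutoff, and that of `Φ`; one derivative formula then serves both. -/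
theorem ofReal_log_hyperplaneProd {x : Fin 3 → ℝ} {z : Fin n → ℝ}
    (hz : z ∉ singularSet n (x 0) (x 1) (x 2)) :
    logSum x 1 1 z = (Real.log (hyperplaneProd x z) : ℂ) := by
  obtain ⟨h1, h2⟩ := sub_ne_zero_of_notMem_singularSet hz
  have h3 : ∀ j, ∀ k ∈ Finset.Ioi j, z j - z k ≠ 0 := fun j k hk =>
    h2 j k (Finset.mem_Ioi.1 hk).ne
  rw [hyperplaneProd, Real.log_mul, Real.log_prod, Real.log_prod]
  · rw [logSum]
    push_cast
    simp only [Pi.one_apply, one_mul]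
    congr 1
    · refine Finset.sum_congr rfl fun i _ => ?_
      rw [Real.log_prod fun a _ => h1 i a]
      push_cast
      rfl
    · refine Finset.sum_congr rfl fun i _ => ?_
      rw [Real.log_prod (h3 i)]
      push_cast
      rfl
  · exact fun j _ => Finset.prod_ne_zero_iff.2 (h3 j)
  · exact fun i _ => Finset.prod_ne_zero_iff.2 fun a _ => h1 i a
  · exact Finset.prod_ne_zero_iff.2 fun i _ => Finset.prod_ne_zero_iff.2 fun a _ => h1 i a
  · exact Finset.prod_ne_zero_iff.2 fun j _ => Finset.prod_ne_zero_iff.2 (h3 j)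

theorem selbergPhi_eq_exp {x : Fin 3 → ℝ} {z : Fin n → ℝ} (α : Fin 3 → ℂ) (τ : ℝ)
    (hz : z ∉ singularSet n (x 0) (x 1) (x 2)) :
    selbergPhi (x 0) (x 1) (x 2) (α 0) (α 1) (α 2) τ z =
      Complex.exp (logSum x (fun a => α a - 1) (2 * τ) z) := by
  obtain ⟨h1, h2⟩ := sub_ne_zero_of_notMem_singularSet hz
  have e1 : ∀ i a, ((|x a - z i| : ℝ) : ℂ) ^ (α a - 1) =
      Complex.exp ((α a - 1) * (Real.log (z i - x a) : ℂ)) := by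
    intro i a
    have hne : |x a - z i| ≠ 0 := by
      rw [abs_ne_zero, ← neg_sub, neg_ne_zero]
      exact h1 i a
    rw [Complex.cpow_def_of_ne_zero (by exact_mod_cast hne), ← Complex.ofReal_log (abs_nonneg _),
      Real.log_abs, ← neg_sub (z i), Real.log_neg_eq_log, mul_comm]
  have e2 : ∀ j, ∀ k ∈ Finset.Ioi j, ((|z j - z k| ^ (2 * τ) : ℝ) : ℂ) =
      Complex.exp (2 * τ * (Real.log (z j - z k) : ℂ)) := by
    intro j k hk
    have hne := h2 j k (Finset.mem_Ioi.1 hk).ne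
    rw [Real.rpow_def_of_pos (abs_pos.2 hne), Real.log_abs]
    push_cast
    rw [mul_comm]
  rw [selbergPhi, logSum, Complex.exp_add, Complex.exp_sum, Finset.mul_sum, Complex.exp_sum]
  congr 1
  · refine Finset.prod_congr rfl fun i _ => ?_
    rw [Complex.exp_sum, Fin.prod_univ_three, e1, e1, e1]
  · rw [Complex.ofReal_prod]
    refine Finset.prod_congr rfl fun j _ => ?_
    rw [Finset.mul_sum, Complex.exp_sum, Complex.ofReal_prod]
    exact Finset.prod_congr rfl (e2 j)

theorem contDiffAt_logSum {x : Fin 3 → ℝ} (β : Fin 3 → ℂ) (γ : ℂ) {z : Fin n → ℝ}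
    (hz : z ∉ singularSet n (x 0) (x 1) (x 2)) : ContDiffAt ℝ 1 (logSum x β γ) z := by
  obtain ⟨h1, h2⟩ := sub_ne_zero_of_notMem_singularSet hz
  unfold logSum
  refine ContDiffAt.add (ContDiffAt.sum fun i _ => ContDiffAt.sum fun a _ =>
    contDiffAt_const.mul ?_) (contDiffAt_const.mul
      (ContDiffAt.sum fun j _ => ContDiffAt.sum fun k hk => ?_))
  · refine Complex.ofRealCLM.contDiff.contDiffAt.comp z (ContDiffAt.log ?_ (h1 i a))
    fun_prop
  · refine Complex.ofRealCLM.contDiff.contDiffAt.comp z (ContDiffAt.log ?_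
      (h2 j k (Finset.mem_Ioi.1 hk).ne))
    fun_prop

/-- The derivative of `logSum` along a field tangent to all singular hyperplanes has no poles. -/
theorem sum_mul_fderiv_logSum {x : Fin 3 → ℝ} (β : Fin 3 → ℂ) (γ : ℂ) {z : Fin n → ℝ}
    (hz : z ∉ singularSet n (x 0) (x 1) (x 2)) {V : Fin n → ℂ} {u : Fin n → Fin 3 → ℂ}
    {U : Fin n → Fin n → ℂ} (hu : ∀ i a, V i = ((z i - x a : ℝ) : ℂ) * u i a)
    (hU : ∀ j k, V j - V k = ((z j - z k : ℝ) : ℂ) * U j k) :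
    ∑ i, V i * fderiv ℝ (logSum x β γ) z (Pi.single i 1) =
      (∑ i, ∑ a, β a * u i a) + γ * ∑ j, ∑ k ∈ Finset.Ioi j, U j k := by
  obtain ⟨h1, h2⟩ := sub_ne_zero_of_notMem_singularSet hz
  have d1 : ∀ i a, HasFDerivAt (fun y : Fin n → ℝ => (Real.log (y i - x a) : ℂ))
      (Complex.ofRealCLM.comp ((z i - x a)⁻¹ •
        (ContinuousLinearMap.proj (R := ℝ) (φ := fun _ : Fin n => ℝ) i))) z := fun i a =>
    Complex.ofRealCLM.hasFDerivAt.comp z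
      (((ContinuousLinearMap.proj (R := ℝ) (φ := fun _ : Fin n => ℝ) i).hasFDerivAt.sub_const
        (x a)).log (h1 i a))
  have d2 : ∀ j, ∀ k ∈ Finset.Ioi j, HasFDerivAt (fun y : Fin n → ℝ => (Real.log (y j - y k) : ℂ))
      (Complex.ofRealCLM.comp ((z j - z k)⁻¹ •
        (ContinuousLinearMap.proj (R := ℝ) (φ := fun _ : Fin n => ℝ) j -
          ContinuousLinearMap.proj (R := ℝ) (φ := fun _ : Fin n => ℝ) k))) z := fun j k hk =>
    Complex.ofRealCLM.hasFDerivAt.comp z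
      (((ContinuousLinearMap.proj (R := ℝ) (φ := fun _ : Fin n => ℝ) j).hasFDerivAt.sub
        (ContinuousLinearMap.proj (R := ℝ) (φ := fun _ : Fin n => ℝ) k).hasFDerivAt).log
          (h2 j k (Finset.mem_Ioi.1 hk).ne))
  have d : HasFDerivAt (logSum x β γ) _ z :=
    (HasFDerivAt.fun_sum fun i (_ : i ∈ Finset.univ) =>
      HasFDerivAt.fun_sum fun a (_ : a ∈ Finset.univ) => (d1 i a).const_mul (β a)).add
    ((HasFDerivAt.fun_sum fun j (_ : j ∈ Finset.univ) => HasFDerivAt.fun_sum (d2 j)).const_mul γ)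
  rw [d.fderiv]
  have e1 : ∀ i a, V i * ((z i - x a : ℝ) : ℂ)⁻¹ = u i a := by
    intro i a
    have : ((z i - x a : ℝ) : ℂ) ≠ 0 := by exact_mod_cast h1 i a
    rw [hu i a]
    field_simp
  have e2 : ∀ j, ∀ k ∈ Finset.Ioi j, (V j - V k) * ((z j - z k : ℝ) : ℂ)⁻¹ = U j k := by
    intro j k hk
    have : ((z j - z k : ℝ) : ℂ) ≠ 0 := by exact_mod_cast h2 j k (Finset.mem_Ioi.1 hk).ne
    rw [hU j k]
    field_simp
  simp only [add_apply, sum_apply,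
    smul_apply, ContinuousLinearMap.comp_apply, ContinuousLinearMap.proj_apply,
    sub_apply, Complex.ofRealCLM_apply, smul_eq_mul, mul_add,
    Finset.sum_add_distrib]
  congr 1
  · simp only [Finset.mul_sum]
    rw [Finset.sum_comm]
    refine Finset.sum_congr rfl fun i _ => ?_
    rw [Finset.sum_comm]
    refine Finset.sum_congr rfl fun a _ => ?_
    rw [Finset.sum_eq_single i]
    · rw [Pi.single_eq_same, ← e1 i a]
      push_cast
      ring
    · intro j _ hj
      simp [Pi.single_eq_of_ne hj.symm]
    · simp
  · simp only [Finset.mul_sum]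
    rw [Finset.sum_comm]
    refine Finset.sum_congr rfl fun j _ => ?_
    rw [Finset.sum_comm]
    refine Finset.sum_congr rfl fun k hk => ?_
    rw [← e2 j k hk]
    have e3 : ∀ i, V i * (γ * (((z j - z k)⁻¹ * ((Pi.single i 1 : Fin n → ℝ) j -
        (Pi.single i 1 : Fin n → ℝ) k) : ℝ) : ℂ)) =
        γ * ((z j - z k : ℝ) : ℂ)⁻¹ * ((if j = i then V i else 0) - if k = i then V i else 0) := by
      intro i
      simp only [Pi.single_apply]
      split_ifs <;> push_cast <;> ring
    simp only [e3]
    rw [← Finset.mul_sum, Finset.sum_sub_distrib, Finset.sum_ite_eq, Finset.sum_ite_eq]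
    simp only [Finset.mem_univ, if_true]
    ring

theorem deriv_smoothTransition_of_one_lt {t : ℝ} (ht : 1 < t) :
    deriv Real.smoothTransition t = 0 := by
  have : Real.smoothTransition =ᶠ[𝓝 t] fun _ => 1 := by
    filter_upwards [lt_mem_nhds ht] with s hs
    exact Real.smoothTransition.one_of_one_le hs.le
  rw [this.deriv_eq, deriv_const]

theorem exists_abs_deriv_smoothTransition_le :
    ∃ M : ℝ, ∀ t, |deriv Real.smoothTransition t| ≤ M := by
  have hc : Continuous (deriv Real.smoothTransition) :=
    (Real.smoothTransition.contDiff (n := 1)).continuous_deriv le_rfl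
  obtain ⟨M, hM⟩ := (isCompact_Icc (a := (0 : ℝ)) (b := 1)).exists_bound_of_continuousOn
    hc.continuousOn
  have hM0 : 0 ≤ M := (norm_nonneg _).trans (hM 0 (by simp))
  refine ⟨M, fun t => ?_⟩
  rcases lt_or_ge t 0 with h | h
  · have : Real.smoothTransition =ᶠ[𝓝 t] fun _ => 0 := by
      filter_upwards [gt_mem_nhds h] with s hs
      exact Real.smoothTransition.zero_of_nonpos hs.le
    rw [this.deriv_eq, deriv_const, abs_zero]
    exact hM0
  · rcases le_or_gt t 1 with h' | h'
    · exact hM t ⟨h, h'⟩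
    · rw [deriv_smoothTransition_of_one_lt h', abs_zero]
      exact hM0

theorem integral_fderiv_apply_eq_zero {F : (Fin n → ℝ) → ℂ} (hF : ContDiff ℝ 1 F)
    (hc : HasCompactSupport F) (v : Fin n → ℝ) : ∫ z, fderiv ℝ F z v = 0 := by
  have hcont : Continuous fun z => fderiv ℝ F z v :=
    (hF.continuous_fderiv one_ne_zero).clm_apply continuous_const
  have hsupp : HasCompactSupport fun z => fderiv ℝ F z v :=
    (hc.fderiv ℝ).comp_left (g := fun L : (Fin n → ℝ) →L[ℝ] ℂ => L v) rfl
  have := integral_smul_fderiv_eq_neg_fderiv_smul_of_integrable (μ := volume)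
    (f := fun _ : Fin n → ℝ => (1 : ℝ)) (g := F) (v := v) (𝕜 := ℝ) (by simp)
    (by simpa using hcont.integrable_of_hasCompactSupport hsupp)
    (by simpa using hF.continuous.integrable_of_hasCompactSupport hc)
    (by fun_prop) (fun z _ => hF.differentiable one_ne_zero z)
  simpa using this

/-- A cutoff function vanishing near the singular hyperplanes. -/
noncomputable def hyperplaneCutoff (x : Fin 3 → ℝ) (N : ℕ) (z : Fin n → ℝ) : ℂ :=
  (Real.smoothTransition ((logSum x 1 1 z).re + N) : ℂ)

theorem contDiffAt_hyperplaneCutoff {x : Fin 3 → ℝ} (N : ℕ) {z : Fin n → ℝ}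
    (hz : z ∉ singularSet n (x 0) (x 1) (x 2)) : ContDiffAt ℝ 1 (hyperplaneCutoff x N) z := by
  refine Complex.ofRealCLM.contDiff.contDiffAt.comp z
    (Real.smoothTransition.contDiffAt.comp z (ContDiffAt.add ?_ contDiffAt_const))
  exact Complex.reCLM.contDiff.contDiffAt.comp z (contDiffAt_logSum 1 1 hz)

theorem fderiv_hyperplaneCutoff {x : Fin 3 → ℝ} (N : ℕ) {z : Fin n → ℝ}
    (hz : z ∉ singularSet n (x 0) (x 1) (x 2)) (v : Fin n → ℝ) :
    fderiv ℝ (hyperplaneCutoff x N) z v =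
      ((deriv Real.smoothTransition ((logSum x 1 1 z).re + N) : ℝ) : ℂ) *
        fderiv ℝ (logSum x 1 1) z v := by
  have hd := ((contDiffAt_logSum (x := x) 1 1 hz).differentiableAt one_ne_zero).hasFDerivAt
  have hre : HasFDerivAt (fun y => (logSum x 1 1 y).re + N)
      (Complex.reCLM.comp (fderiv ℝ (logSum x 1 1) z)) z :=
    (Complex.reCLM.hasFDerivAt.comp z hd).add_const _
  -- Near `z` the function `logSum x 1 1` is real-valued, so its derivative equals that of its real
  -- part, which is what the cutoff involves.
  have hreal : HasFDerivAt (logSum x 1 1)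
      (Complex.ofRealCLM.comp (Complex.reCLM.comp (fderiv ℝ (logSum x 1 1) z))) z := by
    refine HasFDerivAt.congr_of_eventuallyEq (Complex.ofRealCLM.hasFDerivAt.comp z
      (Complex.reCLM.hasFDerivAt.comp z hd)) ?_
    filter_upwards [(isOpen_compl_singularSet x).mem_nhds hz] with y hy
    simp [ofReal_log_hyperplaneProd hy]
  have hval := congrArg (fun L : (Fin n → ℝ) →L[ℝ] ℂ => L v) (hd.unique hreal)
  have hs := (Real.smoothTransition.contDiff (n := 1)).differentiable one_ne_zero
    ((logSum x 1 1 z).re + N)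
  have hcomp := hs.hasDerivAt.comp_hasFDerivAt z hre
  have hcut := Complex.ofRealCLM.hasFDerivAt.comp z hcomp
  change HasFDerivAt (hyperplaneCutoff x N) _ z at hcut
  rw [hcut.fderiv]
  simp only [ContinuousLinearMap.comp_apply, smul_apply,
    Complex.ofRealCLM_apply, Complex.reCLM_apply, smul_eq_mul] at hval ⊢
  rw [hval]
  push_cast
  simp

/-- Stokes' formula for a field tangent to the singular hyperplanes: the divergence of `V Φ`
integrates to zero over an admissible region. -/
theorem integral_divergence_eq_zero {x : Fin 3 → ℝ} {α : Fin 3 → ℂ} {τ : ℝ}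
    {Δ : Set (Fin n → ℝ)}
    (hΔ : IsSelbergRegion Δ (x 0) (x 1) (x 2) (α 0) (α 1) (α 2) τ)
    {V : Fin n → (Fin n → ℝ) → ℂ} {u : Fin n → Fin 3 → (Fin n → ℝ) → ℂ}
    {U : Fin n → Fin n → (Fin n → ℝ) → ℂ} (hV : ∀ i, ContDiff ℝ 1 (V i))
    (hcu : ∀ i a, Continuous (u i a)) (hcU : ∀ j k, Continuous (U j k))
    (hu : ∀ z i a, V i z = ((z i - x a : ℝ) : ℂ) * u i a z)
    (hU : ∀ z j k, V j z - V k z = ((z j - z k : ℝ) : ℂ) * U j k z) :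
    ∫ z in Δ, ((∑ i, fderiv ℝ (V i) z (Pi.single i 1)) +
      ((∑ i, ∑ a, (α a - 1) * u i a z) + 2 * τ * ∑ j, ∑ k ∈ Finset.Ioi j, U j k z)) *
      selbergPhi (x 0) (x 1) (x 2) (α 0) (α 1) (α 2) τ z = 0 := by
  set S := singularSet n (x 0) (x 1) (x 2) with hS
  set Φ := selbergPhi (n := n) (x 0) (x 1) (x 2) (α 0) (α 1) (α 2) τ with hΦ
  set E := logSum (n := n) x (fun a => α a - 1) (2 * τ) with hE
  set G : (Fin n → ℝ) → ℂ := fun z => (∑ i, fderiv ℝ (V i) z (Pi.single i 1)) +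
      ((∑ i, ∑ a, (α a - 1) * u i a z) + 2 * τ * ∑ j, ∑ k ∈ Finset.Ioi j, U j k z) with hG
  set κ : (Fin n → ℝ) → ℂ := fun z =>
    (∑ i, ∑ a, (1 : Fin 3 → ℂ) a * u i a z) + 1 * ∑ j, ∑ k ∈ Finset.Ioi j, U j k z with hκ
  have hGc : Continuous G := by
    refine Continuous.add (continuous_finsetSum _ fun i _ =>
      ((hV i).continuous_fderiv one_ne_zero).clm_apply continuous_const) ?_
    fun_prop
  have hκc : Continuous κ := by fun_prop
  -- `O` is open and differs from `Δ` by a null set, because the frontier lies in the singular set.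
  set O := interior Δ ∩ Sᶜ with hO
  have hOo : IsOpen O := isOpen_interior.inter (isOpen_compl_singularSet x)
  have hΔO : Δ =ᵐ[volume] O := by
    have h0 : ∀ᵐ z, z ∉ S := measure_eq_zero_iff_ae_notMem.1 (volume_singularSet _ _ _)
    filter_upwards [h0] with z hz
    refine propext ⟨fun h => ⟨?_, hz⟩, fun h => interior_subset h.1⟩
    by_contra h'
    exact hz (hΔ.frontier_subset ⟨subset_closure h, h'⟩)
  set F : ℕ → Fin n → (Fin n → ℝ) → ℂ := fun N i =>
    O.indicator fun z => hyperplaneCutoff x N z * V i z * Complex.exp (E z) with hF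
  -- Extension by zero is smooth: near a singular point `|hyperplaneProd| < exp (-N)` and the cutoff
  -- vanishes, while a nonsingular point outside `O` lies outside the closure of `Δ`.
  have hF0 : ∀ N i, ∀ z ∉ O, F N i =ᶠ[𝓝 z] fun _ => 0 := by
    intro N i z hz
    by_cases hzS : z ∈ S
    · have hD : hyperplaneProd x z = 0 := (hyperplaneProd_eq_zero_iff x z).2 hzS
      have hlt : ∀ᶠ y in 𝓝 z, |hyperplaneProd x y| < Real.exp (-N) := by
        refine (continuous_hyperplaneProd x).abs.continuousAt.eventually_lt_const ?_
        simp only [hD, abs_zero]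
        exact Real.exp_pos _
      filter_upwards [hlt] with y hy
      by_cases hyO : y ∈ O
      · have hyD : hyperplaneProd x y ≠ 0 := fun h =>
          hyO.2 ((hyperplaneProd_eq_zero_iff x y).1 h)
        have h3 : (logSum x 1 1 y).re + N ≤ 0 := by
          rw [ofReal_log_hyperplaneProd hyO.2, Complex.ofReal_re, ← Real.log_abs]
          have := (Real.log_lt_iff_lt_exp (abs_pos.2 hyD)).2 hy
          linarith
        simp [hF, hyperplaneCutoff, Real.smoothTransition.zero_of_nonpos h3]
      · simp [hF, hyO]
    · have hzc : z ∉ closure Δ := fun h => by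
        by_cases h' : z ∈ interior Δ
        · exact hz ⟨h', hzS⟩
        · exact hzS (hΔ.frontier_subset ⟨h, h'⟩)
      filter_upwards [isClosed_closure.isOpen_compl.mem_nhds hzc] with y hy
      have hyO : y ∉ O := fun h => hy (interior_subset_closure h.1)
      simp [hF, hyO]
  have hF1 : ∀ N i, ∀ z ∈ O, F N i =ᶠ[𝓝 z]
      fun y => hyperplaneCutoff x N y * V i y * Complex.exp (E y) := by
    intro N i z hz
    filter_upwards [hOo.mem_nhds hz] with y hy
    simp [hF, hy]
  have hFd : ∀ N i, ContDiff ℝ 1 (F N i) := by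
    intro N i
    rw [contDiff_iff_contDiffAt]
    intro z
    by_cases hz : z ∈ O
    · exact (((contDiffAt_hyperplaneCutoff N hz.2).mul (hV i).contDiffAt).mul
        (contDiffAt_logSum _ _ hz.2).cexp).congr_of_eventuallyEq (hF1 N i z hz)
    · exact contDiffAt_const.congr_of_eventuallyEq (hF0 N i z hz)
  have hFs : ∀ N i, HasCompactSupport (F N i) := fun N i =>
    HasCompactSupport.of_support_subset_isCompact hΔ.bounded.isCompact_closure
      (Set.support_indicator_subset.trans fun z hz => interior_subset_closure hz.1)
  set H : ℕ → (Fin n → ℝ) → ℂ := fun N z => ∑ i, fderiv ℝ (F N i) z (Pi.single i 1) with hH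
  have hHc : ∀ N, Continuous (H N) := fun N => continuous_finsetSum _ fun i _ =>
    ((hFd N i).continuous_fderiv one_ne_zero).clm_apply continuous_const
  have hH0 : ∀ N, ∫ z in O, H N z = 0 := by
    intro N
    rw [setIntegral_eq_integral_of_forall_compl_eq_zero]
    · rw [integral_finsetSum]
      · exact Finset.sum_eq_zero fun i _ => integral_fderiv_apply_eq_zero (hFd N i) (hFs N i) _
      · intro i _
        refine Continuous.integrable_of_hasCompactSupport
          (((hFd N i).continuous_fderiv one_ne_zero).clm_apply continuous_const) ?_
        exact ((hFs N i).fderiv ℝ).comp_left (g := fun L : (Fin n → ℝ) →L[ℝ] ℂ => L _) rfl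
    · intro z hz
      refine Finset.sum_eq_zero fun i _ => ?_
      rw [(hF0 N i z hz).fderiv_eq]
      simp
  -- `G` is the divergence of `V Φ` divided by `Φ`. The error term, from differentiating the cutoff,
  -- carries `κ`, the derivative of `log |hyperplaneProd|` along `V`, which by tangency has no
  -- poles.
  have hHO : ∀ N, ∀ z ∈ O, H N z = (hyperplaneCutoff x N z * G z +
      ((deriv Real.smoothTransition ((logSum x 1 1 z).re + N) : ℝ) : ℂ) * κ z) * Φ z := by
    intro N z hz
    have hder : ∀ i, fderiv ℝ (F N i) z (Pi.single i 1) =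
        (hyperplaneCutoff x N z * fderiv ℝ (V i) z (Pi.single i 1) +
          hyperplaneCutoff x N z * (V i z * fderiv ℝ E z (Pi.single i 1)) +
          ((deriv Real.smoothTransition ((logSum x 1 1 z).re + N) : ℝ) : ℂ) *
            (V i z * fderiv ℝ (logSum x 1 1) z (Pi.single i 1))) * Φ z := by
      intro i
      have hc := ((contDiffAt_hyperplaneCutoff N hz.2).differentiableAt one_ne_zero).hasFDerivAt
      have hVd := ((hV i).differentiable one_ne_zero z).hasFDerivAt
      have hEd := ((contDiffAt_logSum (fun a => α a - 1) (2 * τ)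
        hz.2).differentiableAt one_ne_zero).hasFDerivAt
      have hprod : HasFDerivAt
          (fun y => hyperplaneCutoff x N y * V i y * Complex.exp (E y)) _ z :=
        (hc.mul hVd).mul hEd.cexp
      rw [(hF1 N i z hz).fderiv_eq, hprod.fderiv, hΦ,
        selbergPhi_eq_exp α τ hz.2]
      simp only [add_apply, smul_apply, smul_eq_mul,
        fderiv_hyperplaneCutoff N hz.2, ← hE, Pi.mul_apply]
      ring
    rw [hH]
    simp only [hder]
    rw [← Finset.sum_mul, Finset.sum_add_distrib, Finset.sum_add_distrib, ← Finset.mul_sum,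
      ← Finset.mul_sum, ← Finset.mul_sum, sum_mul_fderiv_logSum _ _ hz.2 (hu z) (hU z),
      sum_mul_fderiv_logSum _ _ hz.2 (hu z) (hU z)]
    simp only [hG, hκ]
    ring
  obtain ⟨M, hM⟩ := exists_abs_deriv_smoothTransition_le
  obtain ⟨CG, hCG⟩ := hΔ.bounded.isCompact_closure.exists_bound_of_continuousOn hGc.continuousOn
  obtain ⟨Cκ, hCκ⟩ := hΔ.bounded.isCompact_closure.exists_bound_of_continuousOn hκc.continuousOn
  -- The bound is uniform in `N`, since `G`, `κ` and the derivative of `Real.smoothTransition` are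
  -- bounded on the closure of `Δ`. At each point of `O` the cutoff is eventually locally `1`, so
  -- the integrand is eventually constant in `N`.
  have hlim : Tendsto (fun N => ∫ z in O, H N z) atTop (𝓝 (∫ z in O, G z * Φ z)) := by
    refine tendsto_integral_of_dominated_convergence (fun z => (CG + M * Cκ) * ‖Φ z‖)
      (fun N => (hHc N).aestronglyMeasurable) ?_ ?_ ?_
    · exact ((hΔ.integrable.mono_set (Set.inter_subset_left.trans
        interior_subset)).norm).const_mul _
    · intro N
      filter_upwards [ae_restrict_mem hOo.measurableSet] with z hz
      have hzc : z ∈ closure Δ := interior_subset_closure hz.1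
      rw [hHO N z hz, norm_mul]
      refine mul_le_mul_of_nonneg_right ((norm_add_le _ _).trans (add_le_add ?_ ?_)) (norm_nonneg _)
      · rw [norm_mul, hyperplaneCutoff, Complex.norm_real, Real.norm_eq_abs,
          abs_of_nonneg (Real.smoothTransition.nonneg _)]
        calc _ ≤ 1 * ‖G z‖ := mul_le_mul_of_nonneg_right (Real.smoothTransition.le_one _)
              (norm_nonneg _)
          _ ≤ CG := by rw [one_mul]; exact hCG z hzc
      · rw [norm_mul, Complex.norm_real, Real.norm_eq_abs]
        exact mul_le_mul (hM _) (hCκ z hzc) (norm_nonneg _) ((abs_nonneg _).trans (hM 0))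
    · filter_upwards [ae_restrict_mem hOo.measurableSet] with z hz
      refine tendsto_const_nhds.congr' ?_
      obtain ⟨N₀, hN₀⟩ := exists_nat_gt (1 - (logSum x 1 1 z).re)
      filter_upwards [eventually_ge_atTop N₀] with N hN
      have hN' : (N₀ : ℝ) ≤ N := by exact_mod_cast hN
      have h1 : 1 < (logSum x 1 1 z).re + N := by linarith
      rw [hHO N z hz, hyperplaneCutoff, Real.smoothTransition.one_of_one_le h1.le,
        deriv_smoothTransition_of_one_lt h1]
      simp
  rw [setIntegral_congr_set hΔO]
  simp only [hH0] at hlim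
  exact (tendsto_nhds_unique hlim tendsto_const_nhds)

end Stokes

/-! ### From polynomial relations to vanishing averages. -/

section Averages

open MeasureTheory MvPolynomial

variable {n : ℕ}

theorem IsSelbergRegion.integrableOn_mul {x₁ x₂ x₃ : ℝ} {α₁ α₂ α₃ : ℂ} {τ : ℝ}
    {Δ : Set (Fin n → ℝ)} (hΔ : IsSelbergRegion Δ x₁ x₂ x₃ α₁ α₂ α₃ τ)
    {g : (Fin n → ℝ) → ℂ} (hg : Continuous g) :
    IntegrableOn (fun z => g z * selbergPhi x₁ x₂ x₃ α₁ α₂ α₃ τ z) Δ := by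
  obtain ⟨K, hK⟩ := hΔ.bounded.isCompact_closure.exists_bound_of_continuousOn hg.continuousOn
  refine hΔ.integrable.bdd_mul hg.aestronglyMeasurable (c := K) ?_
  refine ae_mono (Measure.restrict_mono_set volume subset_closure) ?_
  filter_upwards [ae_restrict_mem isClosed_closure.measurableSet] with z hz
  exact hK z hz

/-- The three quadratic polynomials `-∏_{b ≠ a} (y - x b)`. -/
noncomputable def quadVec (x : Fin 3 → ℝ) (y : ℝ) : Fin 3 → ℂ := fun a =>
  -∏ b ∈ Finset.univ.erase a, ((y - x b : ℝ) : ℂ)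

theorem contDiff_ofReal_sub_const (c : ℝ) : ContDiff ℝ 1 fun y : ℝ => ((y - c : ℝ) : ℂ) :=
  Complex.ofRealCLM.contDiff.comp (contDiff_id.sub contDiff_const)

theorem contDiff_quadVec (x : Fin 3 → ℝ) (a : Fin 3) : ContDiff ℝ 1 fun y => quadVec x y a :=
  (contDiff_prod fun b _ => contDiff_ofReal_sub_const (x b)).neg

/-- The right side does not depend on `a`: one cubic factor makes the field vanish on all three
hyperplanes `zᵢ = x a`. -/
theorem sub_mul_quadVec (x : Fin 3 → ℝ) (y : ℝ) (a : Fin 3) :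
    ((y - x a : ℝ) : ℂ) * quadVec x y a = -∏ b, ((y - x b : ℝ) : ℂ) := by
  rw [quadVec, mul_neg, Finset.mul_prod_erase Finset.univ (fun b => ((y - x b : ℝ) : ℂ))
    (Finset.mem_univ a)]

theorem hasDerivAt_neg_prod_sub (x : Fin 3 → ℝ) (y : ℝ) :
    HasDerivAt (fun y : ℝ => -∏ b, ((y - x b : ℝ) : ℂ)) (∑ a, quadVec x y a) y := by
  have h : ∀ b ∈ Finset.univ, HasDerivAt (fun y : ℝ => ((y - x b : ℝ) : ℂ)) 1 y := fun b _ => by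
    simpa using ((hasDerivAt_id y).sub_const (x b)).ofReal_comp
  have h' : HasDerivAt (fun y : ℝ => -∏ b, ((y - x b : ℝ) : ℂ)) _ y :=
    (HasDerivAt.fun_finsetProd h).neg
  convert h' using 1
  simp [quadVec]

theorem contDiff_map_prod_linForm (x : Fin 3 → ℝ) (s : Finset (Fin n))
    (θ : MvPolynomial (Fin 3) ℂ →ₗ[ℂ] ℂ) :
    ContDiff ℝ 1 fun z : Fin n → ℝ => θ (∏ k ∈ s, linForm (quadVec x (z k))) := by
  -- Peeling off a factor replaces `θ` by its composition with multiplication by `X a`.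
  induction s using Finset.induction_on generalizing θ with
  | empty => simpa using contDiff_const
  | insert i s hi ih =>
    have h : ∀ z : Fin n → ℝ, θ (∏ k ∈ insert i s, linForm (quadVec x (z k))) =
        ∑ a, quadVec x (z i) a *
          (θ ∘ₗ LinearMap.mulLeft ℂ (X a)) (∏ k ∈ s, linForm (quadVec x (z k))) := by
      intro z
      rw [Finset.prod_insert hi, linForm, Finset.sum_mul, map_sum]
      simp only [smul_mul_assoc, map_smul, smul_eq_mul, LinearMap.comp_apply,
        LinearMap.mulLeft_apply]
    simp only [h]
    exact ContDiff.sum fun a _ => ((contDiff_quadVec x a).comp (contDiff_apply ℝ ℝ i)).mul (ih _)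

theorem fderiv_prod_erase_single (x : Fin 3 → ℝ) (i : Fin n)
    (θ : MvPolynomial (Fin 3) ℂ →ₗ[ℂ] ℂ) (z : Fin n → ℝ) :
    fderiv ℝ (fun z : Fin n → ℝ => θ (∏ k ∈ Finset.univ.erase i, linForm (quadVec x (z k)))) z
      (Pi.single i 1) = 0 := by
  rw [← ((contDiff_map_prod_linForm x _ θ).differentiable one_ne_zero z).lineDeriv_eq_fderiv,
    lineDeriv]
  have h : ∀ t : ℝ, θ (∏ k ∈ Finset.univ.erase i,
      linForm (quadVec x ((z + t • (Pi.single i 1 : Fin n → ℝ)) k))) =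
      θ (∏ k ∈ Finset.univ.erase i, linForm (quadVec x (z k))) := by
    intro t
    congr 1
    refine Finset.prod_congr rfl fun k hk => ?_
    simp [Pi.single_eq_of_ne (Finset.mem_erase.1 hk).1]
  simp only [h, deriv_const]

/-- Polynomials in the image of `selbergRel` have vanishing Selberg average. -/
theorem integral_fischer_selbergRel {x : Fin 3 → ℝ} {α : Fin 3 → ℂ} {τ : ℝ}
    {Δ : Set (Fin n → ℝ)}
    (hΔ : IsSelbergRegion Δ (x 0) (x 1) (x 2) (α 0) (α 1) (α 2) τ)
    (f : MvPolynomial (Fin 3) ℂ) :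
    ∫ z in Δ, fischer (selbergRel (α 0) (α 1) (α 2) τ f) (∏ k, linForm (quadVec x (z k))) *
      selbergPhi (x 0) (x 1) (x 2) (α 0) (α 1) (α 2) τ z = 0 := by
  set θ := fischer f with hθ
  set W : Fin n → (Fin n → ℝ) → ℂ := fun i z =>
    θ (∏ k ∈ Finset.univ.erase i, linForm (quadVec x (z k))) with hW
  set V : Fin n → (Fin n → ℝ) → ℂ := fun i z => -(∏ b, ((z i - x b : ℝ) : ℂ)) * W i z with hV
  set u : Fin n → Fin 3 → (Fin n → ℝ) → ℂ := fun i a z => quadVec x (z i) a * W i z with hu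
  set U : Fin n → Fin n → (Fin n → ℝ) → ℂ := fun j k z =>
    ∑ a, quadVec x (z j) a * quadVec x (z k) a *
      θ (X a * ∏ l ∈ (Finset.univ.erase j).erase k, linForm (quadVec x (z l))) with hU
  have hWd : ∀ i, ContDiff ℝ 1 (W i) := fun i => contDiff_map_prod_linForm x _ θ
  have hq : ∀ (i : Fin n) a, Continuous fun z : Fin n → ℝ => quadVec x (z i) a := fun i a =>
    (contDiff_quadVec x a).continuous.comp (continuous_apply i)
  have hUs : ∀ j k z, U j k z = U k j z := by
    intro j k z
    simp only [hU, Finset.erase_right_comm (a := j) (b := k)]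
    exact Finset.sum_congr rfl fun a _ => by ring
  -- Expand `W j` along `k` and `W k` along `j`. For each `a` the common factor is `qₐ(zⱼ) qₐ(zₖ)`,
  -- and the coefficients `zⱼ - xₐ` and `zₖ - xₐ` differ by `zⱼ - zₖ`.
  have hUV : ∀ z j k, V j z - V k z = ((z j - z k : ℝ) : ℂ) * U j k z := by
    intro z j k
    by_cases hjk : j = k
    · subst hjk
      simp
    have hWe : ∀ j k : Fin n, j ≠ k → W j z = ∑ a, quadVec x (z k) a *
        θ (X a * ∏ l ∈ (Finset.univ.erase j).erase k, linForm (quadVec x (z l))) := by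
      intro j k hjk
      simp only [hW]
      rw [← Finset.mul_prod_erase (Finset.univ.erase j) _
        (Finset.mem_erase.2 ⟨Ne.symm hjk, Finset.mem_univ k⟩)]
      conv_lhs => rw [linForm, Finset.sum_mul, map_sum]
      simp only [smul_mul_assoc, map_smul, smul_eq_mul]
    simp only [hV, hU]
    rw [hWe j k hjk, hWe k j (Ne.symm hjk), Finset.erase_right_comm (a := k) (b := j),
      Finset.mul_sum, Finset.mul_sum, Finset.mul_sum, ← Finset.sum_sub_distrib]
    refine Finset.sum_congr rfl fun a _ => ?_
    have h1 := sub_mul_quadVec x (z j) a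
    have h2 := sub_mul_quadVec x (z k) a
    push_cast at h1 h2 ⊢
    linear_combination θ (X a * ∏ l ∈ (Finset.univ.erase j).erase k, linForm (quadVec x (z l))) *
      (quadVec x (z j) a * h2 - quadVec x (z k) a * h1)
  have hstokes := integral_divergence_eq_zero (u := u) (U := U) hΔ (V := V)
    (fun i => ContDiff.mul (contDiff_prod fun b _ =>
      (contDiff_ofReal_sub_const (x b)).comp (contDiff_apply ℝ ℝ i)).neg (hWd i))
    (fun i a => (hq i a).mul (hWd i).continuous)
    (fun j k => continuous_finsetSum _ fun a _ => ((hq j a).mul (hq k a)).mul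
      (contDiff_map_prod_linForm x _ (θ ∘ₗ LinearMap.mulLeft ℂ (X a))).continuous)
    (fun z i a => by
      simp only [hV, hu]
      rw [← mul_assoc, sub_mul_quadVec])
    hUV
  rw [← hstokes]
  congr 1
  funext z
  congr 1
  -- `W i` does not involve `zᵢ`, so only the cubic factor is differentiated. The resulting `∑ u`
  -- raises the exponents `αₐ - 1` to the coefficients `αₐ` of `selbergRel`.
  have hdiv : ∀ i, fderiv ℝ (V i) z (Pi.single i 1) = ∑ a, u i a z := by
    intro i
    have hp : HasFDerivAt (fun z : Fin n → ℝ => z i) _ z :=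
      (ContinuousLinearMap.proj (R := ℝ) (φ := fun _ : Fin n => ℝ) i).hasFDerivAt
    have hQ := HasFDerivAt.comp (f := fun z : Fin n → ℝ => z i) z
      (hasDerivAt_neg_prod_sub x (z i)).hasFDerivAt hp
    change HasFDerivAt (fun z : Fin n → ℝ => -∏ b, ((z i - x b : ℝ) : ℂ)) _ z at hQ
    have hVi : HasFDerivAt (V i) _ z :=
      hQ.mul ((hWd i).differentiable one_ne_zero z).hasFDerivAt
    rw [hVi.fderiv]
    simp only [add_apply, smul_apply, hW, fderiv_prod_erase_single]
    simp [hu, hW, Finset.sum_mul, mul_comm]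
  -- Ordered pairs count each `j < k` twice; this is the `2` in the exponent `2τ`.
  have hoff : ∑ i, ∑ j ∈ Finset.univ.erase i, U i j z =
      2 * ∑ j, ∑ k ∈ Finset.Ioi j, U j k z := by
    have := Finset.sum_sum_Ioi_add_eq_sum_sum_off_diag fun j i => U i j z
    simp only [Finset.compl_singleton] at this
    rw [← this, Finset.mul_sum]
    refine Finset.sum_congr rfl fun j _ => ?_
    rw [Finset.mul_sum]
    refine Finset.sum_congr rfl fun k _ => ?_
    rw [hUs k j]
    ring
  have hoff' : ∑ i, ∑ j ∈ Finset.univ.erase i, ∑ a, quadVec x (z i) a * quadVec x (z j) a *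
      fischer f (X a * ∏ k ∈ (Finset.univ.erase i).erase j, linForm (quadVec x (z k))) =
      2 * ∑ j, ∑ k ∈ Finset.Ioi j, U j k z := hoff
  rw [fischer_selbergRel_prod_linForm, hoff']
  simp only [hdiv]
  rw [← add_assoc, ← Finset.sum_add_distrib]
  congr 1
  · refine Finset.sum_congr rfl fun i _ => ?_
    rw [← Finset.sum_add_distrib, Finset.sum_mul]
    refine Finset.sum_congr rfl fun a _ => ?_
    simp only [hu, hW]
    ring
  · ring

/-! ### Translation between monomials in three variables and the symmetrized `basisPoly`. -/

theorem pow_mul_pow_eq_prod_ite {A : Type*} [CommMonoid A] (p q : A) (i : ℕ) (hi : i ≤ n) :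
    p ^ (n - i) * q ^ i = ∏ k : Fin n, if (k : ℕ) < n - i then p else q := by
  rw [Fin.prod_univ_eq_prod_range (fun k => if k < n - i then p else q) n]
  obtain ⟨m, rfl⟩ : ∃ m, n = m + i := ⟨n - i, by omega⟩
  rw [Nat.add_sub_cancel, Finset.prod_range_add]
  congr 1
  · rw [Finset.prod_congr rfl fun k hk => if_pos (Finset.mem_range.1 hk)]
    simp
  · simp

theorem fischer_pow_mul_pow (c d : Fin 3 → ℂ) (v : Fin n → Fin 3 → ℂ) (i : ℕ) (hi : i ≤ n) :
    fischer (linForm c ^ (n - i) * linForm d ^ i) (∏ k, linForm (v k)) =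
      ∑ σ : Equiv.Perm (Fin n), ∏ k : Fin n,
        if (k : ℕ) < n - i then c ⬝ᵥ v (σ k) else d ⬝ᵥ v (σ k) := by
  have h : linForm c ^ (n - i) * linForm d ^ i =
      ∏ k : Fin n, linForm (if (k : ℕ) < n - i then c else d) := by
    rw [pow_mul_pow_eq_prod_ite _ _ i hi]
    exact Finset.prod_congr rfl fun k _ => by split_ifs <;> rfl
  rw [h, fischer_prod_linForm]
  refine Finset.sum_congr rfl fun σ _ => Finset.prod_congr rfl fun k _ => ?_
  split_ifs <;> rfl

theorem linForm_single (a : Fin 3) : linForm (Pi.single a 1) = X a := by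
  simp [linForm, Pi.single_apply]

theorem linForm_sub (c d : Fin 3 → ℂ) : linForm (c - d) = linForm c - linForm d := by
  simp [linForm, sub_smul, Finset.sum_sub_distrib]

theorem quadVec_one (x : Fin 3 → ℝ) (y : ℝ) :
    quadVec x y 1 = ((y - x 0 : ℝ) : ℂ) * ((x 2 - y : ℝ) : ℂ) := by
  rw [quadVec, show (Finset.univ.erase 1 : Finset (Fin 3)) = {0, 2} by decide,
    Finset.prod_pair (by decide)]
  push_cast
  ring

theorem quadVec_two (x : Fin 3 → ℝ) (y : ℝ) :
    quadVec x y 2 = ((y - x 0 : ℝ) : ℂ) * ((x 1 - y : ℝ) : ℂ) := by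
  rw [quadVec, show (Finset.univ.erase 2 : Finset (Fin 3)) = {0, 1} by decide,
    Finset.prod_pair (by decide)]
  push_cast
  ring

theorem quadVec_zero (x : Fin 3 → ℝ) (y : ℝ) :
    quadVec x y 0 = -(((x 1 - y : ℝ) : ℂ) * ((x 2 - y : ℝ) : ℂ)) := by
  rw [quadVec, show (Finset.univ.erase 0 : Finset (Fin 3)) = {1, 2} by decide,
    Finset.prod_pair (by decide)]
  push_cast
  ring

theorem factorial_mul_symmetrize (φ : (Fin n → ℝ) → ℂ) (z : Fin n → ℝ) :
    (n.factorial : ℂ) * symmetrize φ z =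
      ∑ σ : Equiv.Perm (Fin n), φ fun k => z (σ k) := by
  rw [symmetrize, ← mul_assoc, mul_inv_cancel₀ (by exact_mod_cast n.factorial_ne_zero), one_mul]

/-- Both `quadVec x y 1` and `quadVec x y 2` contain `y - x 0`; collected over all coordinates,
these factors form the multiplier of `shiftOp`. -/
theorem fischer_X_pow_mul_X_pow (x : Fin 3 → ℝ) (z : Fin n → ℝ) (i : Fin (n + 1)) :
    fischer (X 2 ^ (n - (i : ℕ)) * X 1 ^ (i : ℕ)) (∏ k, linForm (quadVec x (z k))) =
      n.factorial * ((∏ k, ((z k - x 0 : ℝ) : ℂ)) *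
        symmetrize (basisPoly (x 1) (x 2) i) z) := by
  rw [← linForm_single, ← linForm_single, fischer_pow_mul_pow _ _ _ _ (Nat.lt_succ_iff.1 i.2),
    mul_left_comm, factorial_mul_symmetrize, Finset.mul_sum]
  refine Finset.sum_congr rfl fun σ _ => ?_
  rw [← Equiv.prod_comp σ fun k => ((z k - x 0 : ℝ) : ℂ), basisPoly, ← Finset.prod_mul_distrib]
  refine Finset.prod_congr rfl fun k _ => ?_
  rw [single_one_dotProduct, single_one_dotProduct, quadVec_one, quadVec_two]
  split_ifs <;> rfl

/-- Subtracting `quadVec x y 0` turns the factor `y - x 0` into the constant `x 2 - x 0` or `x 1 - x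
0`, so no shift appears. -/
theorem fischer_sub_pow_mul_sub_pow (x : Fin 3 → ℝ) (z : Fin n → ℝ) (i : Fin (n + 1)) :
    fischer ((X 2 - X 0) ^ (n - (i : ℕ)) * (X 1 - X 0) ^ (i : ℕ))
        (∏ k, linForm (quadVec x (z k))) =
      n.factorial * (((x 2 - x 0 : ℝ) : ℂ) ^ (n - (i : ℕ)) * ((x 1 - x 0 : ℝ) : ℂ) ^ (i : ℕ) *
        symmetrize (basisPoly (x 1) (x 2) i) z) := by
  simp only [← linForm_single]
  rw [← linForm_sub, ← linForm_sub, fischer_pow_mul_pow _ _ _ _ (Nat.lt_succ_iff.1 i.2),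
    mul_left_comm, factorial_mul_symmetrize, Finset.mul_sum]
  refine Finset.sum_congr rfl fun σ _ => ?_
  rw [pow_mul_pow_eq_prod_ite _ _ _ (Nat.lt_succ_iff.1 i.2), basisPoly,
    ← Finset.prod_mul_distrib]
  refine Finset.prod_congr rfl fun k _ => ?_
  simp only [sub_dotProduct, single_one_dotProduct, quadVec_one, quadVec_two, quadVec_zero]
  split_ifs <;> push_cast <;> ring

theorem sum_fin_ite_le {A : Type*} [AddCommMonoid A] (g : ℕ → A) (j : Fin (n + 1)) :
    ∑ i : Fin (n + 1), (if i ≤ j then g i else 0) = ∑ i ∈ Finset.range ((j : ℕ) + 1), g i := by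
  have hj := j.2
  simp only [Fin.le_def]
  rw [Fin.sum_univ_eq_sum_range (fun i => if i ≤ (j : ℕ) then g i else 0), ← Finset.sum_filter]
  refine Finset.sum_congr ?_ fun _ _ => rfl
  ext i
  simp only [Finset.mem_filter, Finset.mem_range]
  omega

theorem sum_fin_ite_ge {A : Type*} [AddCommMonoid A] (g : ℕ → A) (j : Fin (n + 1)) :
    ∑ i : Fin (n + 1), (if j ≤ i then g i else 0) =
      ∑ i ∈ Finset.range (n - (j : ℕ) + 1), g (i + j) := by
  have hj := j.2
  simp only [Fin.le_def]
  rw [Fin.sum_univ_eq_sum_range (fun i => if (j : ℕ) ≤ i then g i else 0),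
    show Finset.range (n + 1) = Finset.range ((j : ℕ) + (n - j + 1)) by congr 1; omega,
    Finset.sum_range_add,
    Finset.sum_eq_zero fun i hi => if_neg (by rw [Finset.mem_range] at hi; omega), zero_add]
  refine Finset.sum_congr rfl fun i _ => ?_
  rw [if_pos (Nat.le_add_right _ _), add_comm]

/-- The two sides of the shift relation differ by an element of the image of `selbergRel`. -/
theorem exists_fischer_selbergRel_eq (x : Fin 3 → ℝ) (α : Fin 3 → ℂ) (τ : ℝ)
    (j : Fin (n + 1)) :
    ∃ w, ∀ z : Fin n → ℝ,
      (∑ i, ((∏ k, ((z k - x 0 : ℝ) : ℂ)) * symmetrize (basisPoly (x 1) (x 2) i) z) *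
          uTilde n (α 0) (α 1) (α 2) τ i j) -
        ∑ i, symmetrize (basisPoly (x 1) (x 2) i) z *
          lTilde n (x 0) (x 1) (x 2) (α 0) (α 1) τ i j =
      (n.factorial : ℂ)⁻¹ *
        fischer (selbergRel (α 0) (α 1) (α 2) τ w) (∏ k, linForm (quadVec x (z k))) := by
  obtain ⟨w, hw⟩ := column_mem_range n j (Nat.lt_succ_iff.1 j.2) (α 0) (α 1) (α 2) τ
  refine ⟨w, fun z => ?_⟩
  have hn : (n.factorial : ℂ) ≠ 0 := by exact_mod_cast n.factorial_ne_zero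
  rw [eq_inv_mul_iff_mul_eq₀ hn, hw, mul_sub, map_sub, LinearMap.sub_apply, Finset.mul_sum,
    Finset.mul_sum, map_sum, map_sum, LinearMap.sum_apply, LinearMap.sum_apply]
  simp only [C_mul', map_smul, LinearMap.smul_apply, smul_eq_mul]
  congr 1
  · rw [← sum_fin_ite_le (fun i => (((j : ℕ).choose i : ℂ) *
        stepPoch (α 0 + α 1 + α 2 + ((n : ℂ) + (j : ℕ) - 1) * τ) τ (n - j) *
        stepPoch (α 2 + ((n : ℂ) - (j : ℕ)) * τ) τ (j - i) *
        stepPoch (α 0 + α 1 + (((j : ℕ) : ℂ) - 1) * τ) τ i) *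
        fischer (X 2 ^ (n - i) * X 1 ^ i) (∏ k, linForm (quadVec x (z k))))]
    refine Finset.sum_congr rfl fun i _ => ?_
    simp only [uTilde, Matrix.of_apply]
    split_ifs
    · rw [fischer_X_pow_mul_X_pow]
      ring
    · simp
  · have hg := sum_fin_ite_ge (fun i => ((-1) ^ (i - (j : ℕ)) *
        ((n - (j : ℕ)).choose (n - i) : ℂ) *
        stepPoch (α 0) τ j * stepPoch (α 1 + (j : ℕ) * τ) τ (i - j) *
        stepPoch (α 0 + α 1 + ((i : ℂ) + (j : ℕ)) * τ) τ (n - i)) *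
        fischer ((X 2 - X 0) ^ (n - i) * (X 1 - X 0) ^ i)
          (∏ k, linForm (quadVec x (z k)))) j
    have hr : ∀ i ∈ Finset.range (n - (j : ℕ) + 1), ((-1) ^ i * ((n - (j : ℕ)).choose i : ℂ) *
        stepPoch (α 0) τ j * stepPoch (α 1 + (j : ℕ) * τ) τ i *
        stepPoch (α 0 + α 1 + ((i : ℂ) + 2 * (j : ℕ)) * τ) τ (n - j - i)) *
        fischer ((X 2 - X 0) ^ (n - j - i) * (X 1 - X 0) ^ (i + j))
          (∏ k, linForm (quadVec x (z k))) =
        ((-1) ^ (i + j - (j : ℕ)) * ((n - (j : ℕ)).choose (n - (i + j)) : ℂ) *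
        stepPoch (α 0) τ j * stepPoch (α 1 + (j : ℕ) * τ) τ (i + j - j) *
        stepPoch (α 0 + α 1 + (((i + j : ℕ) : ℂ) + (j : ℕ)) * τ) τ (n - (i + j))) *
        fischer ((X 2 - X 0) ^ (n - (i + j)) * (X 1 - X 0) ^ (i + j))
          (∏ k, linForm (quadVec x (z k))) := by
      intro i hi
      rw [Finset.mem_range] at hi
      rw [Nat.add_sub_cancel, show n - (i + (j : ℕ)) = n - j - i by omega,
        Nat.choose_symm (by omega)]
      push_cast
      rw [show (i : ℂ) + (j : ℕ) + (j : ℕ) = i + 2 * (j : ℕ) by ring]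
    rw [Finset.sum_congr rfl hr, ← hg]
    refine Finset.sum_congr rfl fun i _ => ?_
    simp only [lTilde, Matrix.of_apply]
    split_ifs
    · rw [fischer_sub_pow_mul_sub_pow]
      ring
    · simp

theorem continuous_basisPoly (x₂ x₃ : ℝ) (i : Fin (n + 1)) :
    Continuous (basisPoly (n := n) x₂ x₃ i) := by
  unfold basisPoly
  refine continuous_finsetProd _ fun k _ => ?_
  split_ifs <;> fun_prop

theorem continuous_symmetrize {φ : (Fin n → ℝ) → ℂ} (hφ : Continuous φ) :
    Continuous (symmetrize φ) := by
  unfold symmetrize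
  refine continuous_const.mul (continuous_finsetSum _ fun σ _ => hφ.comp ?_)
  fun_prop

theorem IsSelbergRegion.sum_selbergAvg_mul {x₁ x₂ x₃ : ℝ} {α₁ α₂ α₃ : ℂ} {τ : ℝ}
    {Δ : Set (Fin n → ℝ)} (hΔ : IsSelbergRegion Δ x₁ x₂ x₃ α₁ α₂ α₃ τ) {ι : Type*} (s : Finset ι)
    {g : ι → (Fin n → ℝ) → ℂ} (hg : ∀ i, Continuous (g i)) (c : ι → ℂ) :
    ∑ i ∈ s, selbergAvg Δ x₁ x₂ x₃ α₁ α₂ α₃ τ (g i) * c i =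
      selbergAvg Δ x₁ x₂ x₃ α₁ α₂ α₃ τ fun z => ∑ i ∈ s, g i z * c i := by
  simp only [selbergAvg, Finset.sum_mul]
  rw [integral_finsetSum]
  · refine Finset.sum_congr rfl fun i _ => ?_
    rw [← integral_mul_const]
    congr 1
    funext z
    ring
  · intro i _
    exact hΔ.integrableOn_mul ((hg i).mul continuous_const)

theorem shiftOp_symmetrize_vecMul_uTilde {x : Fin 3 → ℝ} {α : Fin 3 → ℂ} {τ : ℝ}
    {Δ : Set (Fin n → ℝ)}
    (hΔ : IsSelbergRegion Δ (x 0) (x 1) (x 2) (α 0) (α 1) (α 2) τ) :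
    (fun i => shiftOp (x 0) (selbergAvg Δ (x 0) (x 1) (x 2) (α 0) (α 1) (α 2) τ)
          (symmetrize (basisPoly (x 1) (x 2) i))) ᵥ* uTilde n (α 0) (α 1) (α 2) τ =
      (fun i => selbergAvg Δ (x 0) (x 1) (x 2) (α 0) (α 1) (α 2) τ
          (symmetrize (basisPoly (x 1) (x 2) i))) ᵥ*
        lTilde n (x 0) (x 1) (x 2) (α 0) (α 1) τ := by
  funext j
  obtain ⟨w, hw⟩ := exists_fischer_selbergRel_eq x α τ j
  have hs : ∀ i, Continuous (symmetrize (basisPoly (n := n) (x 1) (x 2) i)) := fun i =>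
    continuous_symmetrize (continuous_basisPoly _ _ i)
  have hA : Continuous fun z : Fin n → ℝ => ∏ k, ((z k - x 0 : ℝ) : ℂ) := by fun_prop
  have hi₁ := hΔ.integrableOn_mul (g := fun z => ∑ i, (∏ k, ((z k - x 0 : ℝ) : ℂ)) *
    symmetrize (basisPoly (x 1) (x 2) i) z * uTilde n (α 0) (α 1) (α 2) τ i j)
    (continuous_finsetSum _ fun i _ => (hA.mul (hs i)).mul continuous_const)
  have hi₂ := hΔ.integrableOn_mul (g := fun z => ∑ i,
    symmetrize (basisPoly (x 1) (x 2) i) z * lTilde n (x 0) (x 1) (x 2) (α 0) (α 1) τ i j)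
    (continuous_finsetSum _ fun i _ => (hs i).mul continuous_const)
  simp only [Matrix.vecMul, dotProduct, shiftOp]
  rw [hΔ.sum_selbergAvg_mul _ (g := fun i z => (∏ k, ((z k - x 0 : ℝ) : ℂ)) *
      symmetrize (basisPoly (x 1) (x 2) i) z) (fun i => hA.mul (hs i)), hΔ.sum_selbergAvg_mul _ hs,
    ← sub_eq_zero, selbergAvg, selbergAvg, ← integral_sub hi₁ hi₂]
  simp only [← sub_mul, hw]
  simp only [mul_assoc]
  rw [integral_const_mul, integral_fischer_selbergRel hΔ, mul_zero]

/-! ### Permutation invariance of `Φ` and of averages over symmetric regions. -/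

theorem selbergPhi_comp_perm (x₁ x₂ x₃ : ℝ) (α₁ α₂ α₃ : ℂ) (τ : ℝ) (σ : Equiv.Perm (Fin n))
    (z : Fin n → ℝ) : selbergPhi x₁ x₂ x₃ α₁ α₂ α₃ τ (fun k => z (σ k)) =
      selbergPhi x₁ x₂ x₃ α₁ α₂ α₃ τ z := by
  -- The product over `j < k` is not permuted factor by factor; as a power of the absolute value of
  -- a Vandermonde product it changes only by a sign inside the absolute value.
  have h : ∀ y : Fin n → ℝ, ∏ j, ∏ k ∈ Finset.Ioi j, |y j - y k| ^ (2 * τ) =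
      |∏ j, ∏ k ∈ Finset.Ioi j, (y j - y k)| ^ (2 * τ) := by
    intro y
    rw [Finset.abs_prod, ← Real.finsetProd_rpow _ _ fun _ _ => abs_nonneg _]
    refine Finset.prod_congr rfl fun j _ => ?_
    rw [Finset.abs_prod, ← Real.finsetProd_rpow _ _ fun _ _ => abs_nonneg _]
  rw [selbergPhi, selbergPhi, h, h,
    σ.prod_Ioi_comp_eq_sign_mul_prod (f := fun j k => z j - z k) fun _ _ => by ring, abs_mul]
  congr 1
  · exact Equiv.prod_comp σ fun i => ((|x₁ - z i| : ℝ) : ℂ) ^ (α₁ - 1) *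
      ((|x₂ - z i| : ℝ) : ℂ) ^ (α₂ - 1) * ((|x₃ - z i| : ℝ) : ℂ) ^ (α₃ - 1)
  · have : |(((σ.sign : ℤˣ) : ℤ) : ℝ)| = 1 := by
      rcases Int.units_eq_one_or σ.sign with h | h <;> simp [h]
    rw [this, one_mul]

theorem selbergAvg_comp_perm {Δ : Set (Fin n → ℝ)}
    (hs : ∀ σ : Equiv.Perm (Fin n), ∀ z ∈ Δ, (fun k => z (σ k)) ∈ Δ)
    (x₁ x₂ x₃ : ℝ) (α₁ α₂ α₃ : ℂ) (τ : ℝ) (φ : (Fin n → ℝ) → ℂ) (σ : Equiv.Perm (Fin n)) :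
    selbergAvg Δ x₁ x₂ x₃ α₁ α₂ α₃ τ (fun z => φ fun k => z (σ k)) =
      selbergAvg Δ x₁ x₂ x₃ α₁ α₂ α₃ τ φ := by
  set e := MeasurableEquiv.piCongrLeft (fun _ : Fin n => ℝ) σ.symm with he
  have hmp : MeasurePreserving e volume volume :=
    volume_measurePreserving_piCongrLeft (fun _ : Fin n => ℝ) σ.symm
  have hev : ∀ z : Fin n → ℝ, e z = fun k => z (σ k) := by
    intro z
    funext k
    have := Equiv.piCongrLeft_apply_apply (fun _ : Fin n => ℝ) σ.symm z (σ k)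
    simpa [he, MeasurableEquiv.coe_piCongrLeft] using this
  -- The hypothesis gives only inclusions; applying it to `σ.symm` as well yields equality.
  have hpre : e ⁻¹' Δ = Δ := by
    ext z
    rw [Set.mem_preimage, hev]
    refine ⟨fun h => ?_, hs σ z⟩
    simpa using hs σ.symm _ h
  have := hmp.setIntegral_preimage_emb e.measurableEmbedding
    (fun z => φ z * selbergPhi x₁ x₂ x₃ α₁ α₂ α₃ τ z) Δ
  rw [hpre] at this
  simpa only [hev, selbergPhi_comp_perm, selbergAvg] using this

theorem IsSelbergRegion.selbergAvg_symmetrize {x₁ x₂ x₃ : ℝ} {α₁ α₂ α₃ : ℂ} {τ : ℝ}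
    {Δ : Set (Fin n → ℝ)} (hΔ : IsSelbergRegion Δ x₁ x₂ x₃ α₁ α₂ α₃ τ)
    (hs : ∀ σ : Equiv.Perm (Fin n), ∀ z ∈ Δ, (fun k => z (σ k)) ∈ Δ)
    {φ : (Fin n → ℝ) → ℂ} (hφ : Continuous φ) :
    selbergAvg Δ x₁ x₂ x₃ α₁ α₂ α₃ τ (symmetrize φ) = selbergAvg Δ x₁ x₂ x₃ α₁ α₂ α₃ τ φ := by
  have hn : (n.factorial : ℂ) ≠ 0 := by exact_mod_cast n.factorial_ne_zero
  have h := hΔ.sum_selbergAvg_mul (Finset.univ : Finset (Equiv.Perm (Fin n)))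
    (g := fun σ z => φ fun k => z (σ k)) (fun σ => hφ.comp (by fun_prop))
    fun _ => (n.factorial : ℂ)⁻¹
  simp only [selbergAvg_comp_perm hs, ← Finset.sum_mul] at h
  rw [Finset.sum_const, Finset.card_univ, Fintype.card_perm, Fintype.card_fin, nsmul_eq_mul,
    mul_right_comm, mul_inv_cancel₀ hn, one_mul] at h
  rw [h]
  congr 1
  funext z
  rw [symmetrize, mul_comm]

theorem symmetrize_prod_sub_mul (y : ℝ) (φ : (Fin n → ℝ) → ℂ) :
    symmetrize (fun z => (∏ i, ((z i - y : ℝ) : ℂ)) * φ z) =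
      fun z => (∏ i, ((z i - y : ℝ) : ℂ)) * symmetrize φ z := by
  funext z
  simp only [symmetrize]
  rw [mul_left_comm, Finset.mul_sum (a := ∏ i, ((z i - y : ℝ) : ℂ))]
  congr 1
  refine Finset.sum_congr rfl fun σ _ => ?_
  rw [Equiv.prod_comp σ fun i => ((z i - y : ℝ) : ℂ)]

end Averages

theorem lemma3p2 (n : ℕ) (x₁ x₂ x₃ : ℝ) (α₁ α₂ α₃ : ℂ) (τ : ℝ) (hτ : 0 < τ)
    (Δ : Set (Fin n → ℝ)) (hΔ : IsSelbergRegion Δ x₁ x₂ x₃ α₁ α₂ α₃ τ) :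
    ((∀ σ : Equiv.Perm (Fin n), ∀ z ∈ Δ, (fun k => z (σ k)) ∈ Δ) →
      (fun i => shiftOp x₁ (selbergAvg Δ x₁ x₂ x₃ α₁ α₂ α₃ τ) (basisPoly x₂ x₃ i)) ᵥ*
          uTilde n α₁ α₂ α₃ τ =
        (fun i => selbergAvg Δ x₁ x₂ x₃ α₁ α₂ α₃ τ (basisPoly x₂ x₃ i)) ᵥ*
          lTilde n x₁ x₂ x₃ α₁ α₂ τ) ∧
    (fun i => shiftOp x₁ (selbergAvg Δ x₁ x₂ x₃ α₁ α₂ α₃ τ)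
          (symmetrize (basisPoly x₂ x₃ i))) ᵥ* uTilde n α₁ α₂ α₃ τ =
      (fun i => selbergAvg Δ x₁ x₂ x₃ α₁ α₂ α₃ τ (symmetrize (basisPoly x₂ x₃ i))) ᵥ*
        lTilde n x₁ x₂ x₃ α₁ α₂ τ := by
  have hb := shiftOp_symmetrize_vecMul_uTilde (x := ![x₁, x₂, x₃]) (α := ![α₁, α₂, α₃]) hΔ
  refine ⟨fun hs => ?_, hb⟩
  have h1 : ∀ i, selbergAvg Δ x₁ x₂ x₃ α₁ α₂ α₃ τ (symmetrize (basisPoly x₂ x₃ i)) =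
      selbergAvg Δ x₁ x₂ x₃ α₁ α₂ α₃ τ (basisPoly x₂ x₃ i) := fun i =>
    hΔ.selbergAvg_symmetrize hs (continuous_basisPoly x₂ x₃ i)
  have h2 : ∀ i, shiftOp x₁ (selbergAvg Δ x₁ x₂ x₃ α₁ α₂ α₃ τ)
        (symmetrize (basisPoly x₂ x₃ i)) =
      shiftOp x₁ (selbergAvg Δ x₁ x₂ x₃ α₁ α₂ α₃ τ) (basisPoly x₂ x₃ i) := by
    intro i
    have hA : Continuous fun z : Fin n → ℝ => ∏ k, ((z k - x₁ : ℝ) : ℂ) := by fun_prop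
    -- The shift factor is symmetric, so it passes inside the symmetrization.
    rw [shiftOp, shiftOp, ← symmetrize_prod_sub_mul]
    exact hΔ.selbergAvg_symmetrize hs (hA.mul (continuous_basisPoly x₂ x₃ i))
  simp only [← h1, ← h2]
  exact hb
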